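/- **Setting.** Fix a non-empty finite set $\mathcal C$ of constants (integers and symbols), a supply of variables and of time variables, and a set of predicate names divided into extensional names for background data, extensional names for data streams, and intensional names; infinitely many intensional names are available. A predicate atom is $p(x_1,\dots,x_k)$, $k\ge 0$, where the $x_i$ are variables or constants; a ground atom has no variables. A stream $\langle S_0,\dots,S_n\rangle$ is a sequence of sets of ground atoms, and streams of the same length are compared by pointwise inclusion. An input stream $I=\langle I_0,\dots,I_n\rangle$ contains only atoms with stream predicates, and background data $B$ is a set of ground atoms with background predicates. **LDSR.** Streaming atoms are $a\ \mathbf{at\ least}\ c\ \mathbf{in}\ D$, $a\ \mathbf{always\ in}\ D$ and $a\ \mathbf{count}\ s\ \mathbf{in}\ D$, with $D\subset\mathbb N$ finite and non-empty, $c$ a positive integer, and $s$ a positive integer or a variable ($a$ alone means $a\ \mathbf{at\ least}\ 1\ \mathbf{in}\ \{0\}$). For $\Sigma=\langle S_0,\dots,S_n\rangle$ and ground $a$, let $N$ be the number of time points $i=n-d\ge 0$ with $d\in D$ and $a\in S_i$. Then $\Sigma$ entails the first atom iff $N\ge c$, the third iff $N=s$, and the second iff $a\in S_i$ for all $i=n-d\geq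 0$ with $d\in D$; $\mathtt{not}\,\alpha$ holds iff $\alpha$ does not. A rule is $a\ \text{:-}\ l_1,\dots,l_b$ (form (1)) or $\#\mathbf{temp}\ a\ \text{:-}\ l_1,\dots,l_b$ (form (2)), whose literals are positive or negated streaming atoms, built-in comparisons of arithmetic terms, or positive or negated ASP-Core-2 aggregate atoms ($\#count,\#sum,\#max,\#min$; plain atoms in aggregates refer to the last time point). It is safe if every variable of its head or of a negative streaming literal occurs in a positive streaming literal. An LDSR program is a finite set $P$ of safe rules that is stratified: $P$ can be partitioned into strata $\Pi_1,\dots,\Pi_k$ such that, for every rule in $\Pi_i$, the rules defining the predicate of a positive $\mathbf{at\ least}$ or $\mathbf{always}$ body literal lie in $\Pi_1\cup\dots\cup\Pi_i$, and those defining a predicate of any other body literal (a $\mathbf{count}$ atom, a negative literal, an aggregate literal) lie in $\Pi_1\cup\dots\cup\Pi_{i-1}$. $Gr(P)$ is the set of ground instances over $\mathcal C$, where variables used as counting terms are replaced by positive integers only. A stream $M\supseteq\Sigma$ of the same length as $\Sigma$ is a model of a set of ground rules for $\Sigma$ if for each rule whose body is entailed by $M$, the head is true in $M$ at the last time point; the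 reduct $P^M$ consists of the rules of $Gr(P)$ whose body $M$ entails. The permanent part of a model $M$ for $\Sigma$ is obtained by deleting from its last set all atoms that are neither in the last set of $\Sigma$ nor the head of a form-(1) rule of $Gr(P)$ with body entailed by $M$. The stream $\Sigma'=\langle S'_0,\dots,S'_n\rangle\supseteq\Sigma$ is an answer stream of $P$ for $\Sigma$ if, for each $i<n$, $\langle S'_0,\dots,S'_i\rangle$ is the permanent part of an $M$ that is a minimal model of $P^M$ for $\langle S'_0,\dots,S'_{i-1},S_i\rangle$, and $\Sigma'$ is a minimal model of $P^{\Sigma'}$ for $\langle S'_0,\dots,S'_{n-1},S_n\rangle$. For $0\le t\le n$, the output $t\text{-}bound(I,B,P)=\langle O_0,\dots,O_n\rangle$ is given by the answer stream $\langle O_0,\dots,O_t\rangle$ of $P\cup\{b.\mid b\in B\}$ for $\langle I_0,\dots,I_t\rangle$, and $O_i=\emptyset$ for $i>t$. **LARS.** Formulas are $\alpha::=a\mid\neg\alpha\mid\alpha\wedge\alpha\mid\alpha\vee\alpha\mid\alpha\to\alpha\mid\Diamond\alpha\mid\Box\alpha\mid @_s\alpha\mid\boxplus^w\alpha\mid\triangleright\alpha$,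 with $a$ a predicate atom, $s$ a natural number or a time variable, and $w\in\mathbb N$. For a stream $\Sigma=\langle S_0,\dots,S_n\rangle$, a set $T$ of time points (a substream) and $t\in T$: an atom $a$ holds at $t$ iff $a\in S_t$ or $a\in B$; the Boolean connectives are classical; $\Diamond$ and $\Box$ quantify over $T$; $@_s\alpha$ holds iff $s\in T$ and $\alpha$ holds at $s$; $\boxplus^w$ replaces $T$ by $T\cap[t-w,t]$; $\triangleright$ replaces $T$ by $\{0,\dots,n\}$. Initially $T=\{0,\dots,n\}$. A program is a set of rules $\alpha\leftarrow\beta_1,\dots,\beta_m$ between formulas, grounded by replacing variables with constants and time variables with time points of the stream. $\Sigma$ is an interpretation stream for $I$ if $\Sigma\supseteq I$ has the same length and every atom of $\Sigma$ not in $I$ at the same time point is intensional. An interpretation stream $\Sigma$ is an answer stream of $Q$ for $I$ at $t$ (given $B$) if it is a $\subseteq$-minimal model, among the interpretation streams for $I$, at $t$ of the ground rules of $Q$ whose body holds in $\Sigma$ at $t$. $\mathit{LARS}_D$ is the set of finite programs that have exactly one answer stream $AS(Q,I,t)$ for all $n$, input streams $I$, background data $B$ and $t\in\{0,\dots,n\}$.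 If $AS(Q,I,t)=\langle A_0,\dots,A_n\rangle$, then $t\text{-}bound(I,B,Q)=\langle O_0,\dots,O_n\rangle$ with $O_i=A_i\cup B$ for $i\le t$ and $O_i=\emptyset$ for $i>t$. **Proposition.** Let $F_4$ be the set of LDSR programs in which the predicates of all rule heads are intensional. Then $F_4$ is bound-expressible via $\mathit{LARS}_D$ (auxiliary predicates being allowed): there is a mapping $\rho_4:F_4\to\mathit{LARS}_D$ such that, for all $P\in F_4$, all $n\in\mathbb N$, all input streams $I=\langle I_0,\dots,I_n\rangle$, all background data $B$ and all $t\in\{0,\dots,n\}$, both outputs below are well defined (exist and are unique) and $$t\text{-}bound(I,B,P)=t\text{-}bound(I,B,\rho_4(P))\big|_{pred(P\cup I\cup B)},$$ where $|_F$ keeps the atoms with predicates in $F$ and $pred(\cdot)$ is the set of predicates that occur. -/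

import Mathlib

namespace StreamReasoning

/-! ### Vocabulary, atoms and streams -/

/-- The three kinds of predicate names: extensional for background data, extensional for data
streams, and intensional. -/
inductive PredKind
  | background
  | stream
  | intensional

/-- Potential constants: integers and symbols, with the usual total order of answer set
programming in which integers precede symbols. -/
abbrev Value (Sym : Type*) := ℤ ⊕ₗ Sym

/-- An integer as a constant. -/
def Value.ofInt {Sym : Type*} (z : ℤ) : Value Sym := toLex (Sum.inl z)

/-- The integer denoted by a constant, if there is one. -/
def Value.toInt? {Sym : Type*} (x : Value Sym) : Option ℤ :=
  match ofLex x with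
  | Sum.inl z => some z
  | Sum.inr _ => none

/-- Terms over a set `C` of constants; variables are named by natural numbers. -/
inductive Term (C : Type*)
  | var (v : ℕ)
  | const (c : C)

/-- The value of a term under a substitution of constants for variables. -/
def Term.subst {C : Type*} (σ : ℕ → C) : Term C → C
  | .var v => σ v
  | .const c => c

/-- A predicate atom `p(x₁, …, xₖ)`, `k ≥ 0`. The atoms of programs have arguments in `Term C`,
the ground atoms have arguments in `C`. -/
structure Atom (Pred X : Type*) where
  pred : Pred
  args : List X

/-- The ground instance of an atom under a substitution. -/
def Atom.subst {Pred C : Type*} (σ : ℕ → C) (a : Atom Pred (Term C)) : Atom Pred C :=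
  ⟨a.pred, a.args.map (Term.subst σ)⟩

/-- The variables of an atom. -/
def Atom.vars {Pred C : Type*} (a : Atom Pred (Term C)) : Set ℕ :=
  {v | Term.var v ∈ a.args}

/-- A stream `⟨S₀, …, Sₙ⟩` of sets of ground atoms. Streams of the same length are ordered by
pointwise inclusion. -/
abbrev FinStream (A : Type*) (n : ℕ) := Fin (n + 1) → Set A

/-- The restriction `⟨S₀, …, Sₘ⟩` of `⟨S₀, …, Sₙ⟩`, for `m ≤ n`. -/
def FinStream.restrict {A : Type*} {n : ℕ} (S : FinStream A n) (m : ℕ) (h : m ≤ n) : FinStream A m :=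
  fun i => S (Fin.castLE (Nat.succ_le_succ h) i)

/-- The restriction of a stream of ground atoms to the atoms with predicates in `F`. -/
def FinStream.filterPred {Pred C : Type*} {n : ℕ} (S : FinStream (Atom Pred C) n) (F : Set Pred) :
    FinStream (Atom Pred C) n :=
  fun i => {a | a ∈ S i ∧ a.pred ∈ F}

/-- Input streams consist of ground atoms with extensional predicates for data streams. -/
def IsInput {Pred C : Type*} (kind : Pred → PredKind) {n : ℕ} (I : FinStream (Atom Pred C) n) :
    Prop :=
  ∀ i, ∀ a ∈ I i, kind a.pred = PredKind.stream

/-- Background data are ground atoms with extensional predicates for background data. -/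
def IsBackground {Pred C : Type*} (kind : Pred → PredKind) (B : Set (Atom Pred C)) : Prop :=
  ∀ a ∈ B, kind a.pred = PredKind.background

/-! ### LDSR: syntax -/

namespace LDSR

/-- Counting terms: positive integers and variables. -/
inductive CountTerm
  | num (k : ℕ+)
  | var (v : ℕ)

/-- The streaming atoms `a at least c in D`, `a always in D` and `a count t in D`, where `D` is a
finite nonempty set of natural numbers. A plain atom `a` stands for `a at least 1 in {0}`. -/
inductive StreamingAtom (Pred C : Type*)
  | atLeast (a : Atom Pred (Term C)) (c : ℕ+) (D : {D : Finset ℕ // D.Nonempty})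
  | always (a : Atom Pred (Term C)) (D : {D : Finset ℕ // D.Nonempty})
  | count (a : Atom Pred (Term C)) (t : CountTerm) (D : {D : Finset ℕ // D.Nonempty})

/-- Arithmetic terms, used in built-in atoms and in aggregates. -/
inductive ArithTerm (Sym : Type*)
  | const (x : Value Sym)
  | var (v : ℕ)
  | neg (t : ArithTerm Sym)
  | add (t u : ArithTerm Sym)
  | sub (t u : ArithTerm Sym)
  | mul (t u : ArithTerm Sym)
  | div (t u : ArithTerm Sym)

/-- The comparison symbols of built-in and aggregate atoms. -/
inductive CompOp
  | lt
  | le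
  | eq
  | ne
  | gt
  | ge

/-- The aggregate functions. -/
inductive AggFun
  | count
  | sum
  | max
  | min

/-- The literals that may occur in the condition of an aggregate element: atoms, negated atoms and
built-in atoms. -/
inductive CondLit (Pred Sym C : Type*)
  | pos (a : Atom Pred (Term C))
  | neg (a : Atom Pred (Term C))
  | builtin (t : ArithTerm Sym) (op : CompOp) (u : ArithTerm Sym)

/-- An aggregate element `t₁, …, tₘ : l₁, …, lₙ`. -/
structure AggElem (Pred Sym C : Type*) where
  terms : List (ArithTerm Sym)
  conds : List (CondLit Pred Sym C)

/-- An aggregate atom `#f {e₁; …; eₘ} ≺ u`. -/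
structure AggAtom (Pred Sym C : Type*) where
  fn : AggFun
  elems : List (AggElem Pred Sym C)
  op : CompOp
  guard : ArithTerm Sym

/-- Body literals: positive and negative streaming literals, built-in atoms, and positive and
negative aggregate literals. -/
inductive Lit (Pred Sym C : Type*)
  | pos (α : StreamingAtom Pred C)
  | neg (α : StreamingAtom Pred C)
  | builtin (t : ArithTerm Sym) (op : CompOp) (u : ArithTerm Sym)
  | agg (A : AggAtom Pred Sym C)
  | notAgg (A : AggAtom Pred Sym C)

/-- Rules `a :- l₁, …, l_b` (form (1), `temp = false`) and `#temp a :- l₁, …, l_b`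
(form (2), `temp = true`). -/
structure Rule (Pred Sym C : Type*) where
  temp : Bool
  head : Atom Pred (Term C)
  body : List (Lit Pred Sym C)

variable {Pred Sym C : Type*}

def StreamingAtom.atom : StreamingAtom Pred C → Atom Pred (Term C)
  | .atLeast a _ _ => a
  | .always a _ => a
  | .count a _ _ => a

/-- The variable used as the counting term, if there is one. -/
def StreamingAtom.countVars : StreamingAtom Pred C → Set ℕ
  | .count _ (.var v) _ => {v}
  | _ => ∅

def StreamingAtom.vars (α : StreamingAtom Pred C) : Set ℕ := α.atom.vars ∪ α.countVars

def ArithTerm.vars : ArithTerm Sym → Set ℕ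
  | .const _ => ∅
  | .var v => {v}
  | .neg t => t.vars
  | .add t u => t.vars ∪ u.vars
  | .sub t u => t.vars ∪ u.vars
  | .mul t u => t.vars ∪ u.vars
  | .div t u => t.vars ∪ u.vars

def CondLit.preds : CondLit Pred Sym C → Set Pred
  | .pos a => {a.pred}
  | .neg a => {a.pred}
  | .builtin _ _ _ => ∅

def AggAtom.preds (A : AggAtom Pred Sym C) : Set Pred :=
  {p | ∃ e ∈ A.elems, ∃ c ∈ e.conds, p ∈ c.preds}

/-- The variables of a literal that occur outside aggregate elements. -/
def Lit.globalVars : Lit Pred Sym C → Set ℕ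
  | .pos α => α.vars
  | .neg α => α.vars
  | .builtin t _ u => t.vars ∪ u.vars
  | .agg A => A.guard.vars
  | .notAgg A => A.guard.vars

/-- The global variables of a rule, that is, those occurring outside aggregate elements. All other
variables are local to the aggregate elements in which they occur. -/
def Rule.globalVars (r : Rule Pred Sym C) : Set ℕ :=
  r.head.vars ∪ {v | ∃ l ∈ r.body, v ∈ l.globalVars}

def Lit.countVars : Lit Pred Sym C → Set ℕ
  | .pos α => α.countVars
  | .neg α => α.countVars
  | _ => ∅

/-- The predicate of a harmless literal `a at least c in D` or `a always in D`. -/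
def Lit.harmlessPreds : Lit Pred Sym C → Set Pred
  | .pos (.atLeast a _ _) => {a.pred}
  | .pos (.always a _) => {a.pred}
  | _ => ∅

/-- The predicates of a non-harmless literal: literals `a count t in D`, negative literals, and
aggregate literals. -/
def Lit.nonHarmlessPreds : Lit Pred Sym C → Set Pred
  | .pos (.count a _ _) => {a.pred}
  | .neg α => {α.atom.pred}
  | .agg A => A.preds
  | .notAgg A => A.preds
  | _ => ∅

/-- The predicates occurring in a rule. -/
def Rule.preds (r : Rule Pred Sym C) : Set Pred :=
  {r.head.pred} ∪ {p | ∃ l ∈ r.body, p ∈ l.harmlessPreds ∪ l.nonHarmlessPreds}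

/-- A rule is safe if all variables of the head and of the negative streaming literals also occur
in a positive streaming literal. -/
def Rule.Safe (r : Rule Pred Sym C) : Prop :=
  ∀ v, (v ∈ r.head.vars ∨ ∃ α, Lit.neg α ∈ r.body ∧ v ∈ α.vars) →
    ∃ α, Lit.pos α ∈ r.body ∧ v ∈ α.vars

/-- Stratification; `level` assigns to each rule the index of its stratum. -/
def Stratified (P : Set (Rule Pred Sym C)) : Prop :=
  ∃ level : Rule Pred Sym C → ℕ, ∀ r ∈ P, ∀ l ∈ r.body, ∀ r' ∈ P,
    (r'.head.pred ∈ l.harmlessPreds → level r' ≤ level r) ∧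
    (r'.head.pred ∈ l.nonHarmlessPreds → level r' < level r)

/-- LDSR programs: finite stratified sets of safe rules. -/
def IsProgram (P : Set (Rule Pred Sym C)) : Prop :=
  P.Finite ∧ (∀ r ∈ P, r.Safe) ∧ Stratified P

/-- The facts `b.` for `b ∈ B`. -/
def facts (B : Set (Atom Pred C)) : Set (Rule Pred Sym C) :=
  {r | ∃ b ∈ B, r = ⟨false, ⟨b.pred, b.args.map Term.const⟩, []⟩}

/-! ### LDSR: semantics -/

/-- Apply a partial integer operation to the values of two terms; undefined unless both are
integers. -/
def intOp (f : ℤ → ℤ → Option ℤ) (x y : Option (Value Sym)) : Option (Value Sym) :=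
  (x.bind Value.toInt?).bind fun a => (y.bind Value.toInt?).bind fun b =>
    (f a b).map Value.ofInt

/-- Evaluation of an arithmetic term; `none` if it is not well-defined. -/
def ArithTerm.eval (σ : ℕ → Value Sym) : ArithTerm Sym → Option (Value Sym)
  | .const x => some x
  | .var v => some (σ v)
  | .neg t => intOp (fun a b => some (a - b)) (some (Value.ofInt 0)) (t.eval σ)
  | .add t u => intOp (fun a b => some (a + b)) (t.eval σ) (u.eval σ)
  | .sub t u => intOp (fun a b => some (a - b)) (t.eval σ) (u.eval σ)
  | .mul t u => intOp (fun a b => some (a * b)) (t.eval σ) (u.eval σ)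
  | .div t u => intOp (fun a b => if b = 0 then none else some (a.tdiv b)) (t.eval σ) (u.eval σ)

def CompOp.Holds {X : Type*} [LT X] [LE X] : CompOp → X → X → Prop
  | .lt, x, y => x < y
  | .le, x, y => x ≤ y
  | .eq, x, y => x = y
  | .ne, x, y => x ≠ y
  | .gt, x, y => y < x
  | .ge, x, y => y ≤ x

/-- The time points `n - d ≥ 0` with `d ∈ D`, which index the backward observation of a stream
`⟨S₀, …, Sₙ⟩` with respect to `D`. -/
def backward (n : ℕ) (D : Finset ℕ) : Set (Fin (n + 1)) :=
  {i | ∃ d ∈ D, (i : ℕ) + d = n}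

/-- The number of members of the backward observation that contain `a`. -/
noncomputable def occurrences {n : ℕ} (S : FinStream (Atom Pred C) n) (D : Finset ℕ)
    (a : Atom Pred C) : ℕ :=
  {i | i ∈ backward n D ∧ a ∈ S i}.ncard

section Semantics

variable [LinearOrder Sym] {𝒞 : Finset (Value Sym)}

/-- `S ⊨ ασ` for a streaming atom `α` and a substitution `σ`. -/
def StreamingAtom.Holds {n : ℕ} (S : FinStream (Atom Pred 𝒞) n) (σ : ℕ → 𝒞) :
    StreamingAtom Pred 𝒞 → Prop
  | .atLeast a c D => (c : ℕ) ≤ occurrences S D.1 (a.subst σ)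
  | .always a D => ∀ i ∈ backward n D.1, a.subst σ ∈ S i
  | .count a (.num k) D => occurrences S D.1 (a.subst σ) = (k : ℕ)
  | .count a (.var v) D => Value.ofInt (occurrences S D.1 (a.subst σ) : ℤ) = (σ v : Value Sym)

/-- Truth of a built-in atom under a substitution; false if one of its terms is not well-defined,
so that ill-formed instances of rules and of aggregate elements have no effect. -/
def builtinHolds (σ : ℕ → 𝒞) (t : ArithTerm Sym) (op : CompOp) (u : ArithTerm Sym) : Prop :=
  ∃ x y, t.eval (fun v => (σ v : Value Sym)) = some x ∧
    u.eval (fun v => (σ v : Value Sym)) = some y ∧ op.Holds x y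

/-- Truth of an aggregate condition; its atoms refer to the last time point. -/
def CondLit.Holds {n : ℕ} (S : FinStream (Atom Pred 𝒞) n) (σ : ℕ → 𝒞) : CondLit Pred Sym 𝒞 → Prop
  | .pos a => a.subst σ ∈ S (Fin.last n)
  | .neg a => a.subst σ ∉ S (Fin.last n)
  | .builtin t op u => builtinHolds σ t op u

/-- The set of tuples collected by an aggregate atom: the tuples `t₁, …, tₘ` of the instances of its
elements with true condition, where the variables in `G` are fixed by `σ` and all other variables
are local and range over the constants. -/
def AggAtom.tuples {n : ℕ} (S : FinStream (Atom Pred 𝒞) n) (G : Set ℕ) (σ : ℕ → 𝒞)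
    (A : AggAtom Pred Sym 𝒞) : Set (List (Value Sym)) :=
  {x | ∃ e ∈ A.elems, ∃ τ : ℕ → 𝒞, (∀ v ∈ G, τ v = σ v) ∧
    List.Forall₂ (fun t y => ArithTerm.eval (fun v => (τ v : Value Sym)) t = some y) e.terms x ∧
    ∀ c ∈ e.conds, c.Holds S τ}

/-- The first components of a set of tuples. -/
def firsts (T : Set (List (Value Sym))) : Set (Value Sym) :=
  {m | ∃ x ∈ T, x.head? = some m}

/-- The integer in the first component of a tuple; `0` if there is none. -/
def firstInt (x : List (Value Sym)) : ℤ := ((x.head?).bind Value.toInt?).getD 0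

/-- `f(T) ≺ u` for an aggregate function `f`; the maximum of the empty set lies below, and its
minimum above, all constants. -/
def AggFun.Compare (T : Set (List (Value Sym))) (op : CompOp) (u : Value Sym) : AggFun → Prop
  | .count => op.Holds (Value.ofInt (T.ncard : ℤ)) u
  | .sum => op.Holds (Value.ofInt (∑ᶠ x ∈ T, firstInt x)) u
  | .max => (firsts T = ∅ ∧ op.Holds (⊥ : WithBot (Value Sym)) (u : WithBot (Value Sym))) ∨
      ∃ m, IsGreatest (firsts T) m ∧ op.Holds m u
  | .min => (firsts T = ∅ ∧ op.Holds (⊤ : WithTop (Value Sym)) (u : WithTop (Value Sym))) ∨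
      ∃ m, IsLeast (firsts T) m ∧ op.Holds m u

/-- Truth of a body literal under a substitution `σ` of the global variables `G`. As for built-in
atoms, an aggregate literal with ill-defined guard makes the instance of the rule ineffective. -/
def Lit.Holds {n : ℕ} (S : FinStream (Atom Pred 𝒞) n) (G : Set ℕ) (σ : ℕ → 𝒞) :
    Lit Pred Sym 𝒞 → Prop
  | .pos α => α.Holds S σ
  | .neg α => ¬ α.Holds S σ
  | .builtin t op u => builtinHolds σ t op u
  | .agg A => ∃ u, A.guard.eval (fun v => (σ v : Value Sym)) = some u ∧
      A.fn.Compare (A.tuples S G σ) A.op u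
  | .notAgg A => ∃ u, A.guard.eval (fun v => (σ v : Value Sym)) = some u ∧
      ¬ A.fn.Compare (A.tuples S G σ) A.op u

/-- A ground instance of a rule: a rule with a substitution. -/
structure GroundRule (Pred : Type*) {Sym : Type*} (𝒞 : Finset (Value Sym)) where
  rule : Rule Pred Sym 𝒞
  σ : ℕ → 𝒞

def GroundRule.head (g : GroundRule Pred 𝒞) : Atom Pred 𝒞 := g.rule.head.subst g.σ

/-- `S ⊨ B(g)`. -/
def GroundRule.BodyHolds {n : ℕ} (S : FinStream (Atom Pred 𝒞) n) (g : GroundRule Pred 𝒞) : Prop :=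
  ∀ l ∈ g.rule.body, l.Holds S g.rule.globalVars g.σ

/-- `S ⊨ H(g)`: the head is true at the last time point. -/
def GroundRule.HeadHolds {n : ℕ} (S : FinStream (Atom Pred 𝒞) n) (g : GroundRule Pred 𝒞) : Prop :=
  g.head ∈ S (Fin.last n)

/-- The ground instantiation of a program; variables used as counting terms are replaced by
positive integers only. -/
def ground (P : Set (Rule Pred Sym 𝒞)) : Set (GroundRule Pred 𝒞) :=
  {g | g.rule ∈ P ∧ ∀ l ∈ g.rule.body, ∀ v ∈ l.countVars,
    ∃ k : ℕ+, (g.σ v : Value Sym) = Value.ofInt ((k : ℕ) : ℤ)}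

/-- `S'` is a model of a set of ground rules for `S`. -/
def IsModel (R : Set (GroundRule Pred 𝒞)) {n : ℕ} (S S' : FinStream (Atom Pred 𝒞) n) : Prop :=
  S ≤ S' ∧ ∀ g ∈ R, g.BodyHolds S' → g.HeadHolds S'

/-- `S'` is a minimal model of a set of ground rules for `S`. -/
def IsMinimalModel (R : Set (GroundRule Pred 𝒞)) {n : ℕ} (S S' : FinStream (Atom Pred 𝒞) n) : Prop :=
  IsModel R S S' ∧ ∀ Ω, IsModel R S Ω → ¬ Ω < S'

/-- The reduct of `P` with respect to `S'`. -/
def reduct (P : Set (Rule Pred Sym 𝒞)) {n : ℕ} (S' : FinStream (Atom Pred 𝒞) n) :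
    Set (GroundRule Pred 𝒞) :=
  {g | g ∈ ground P ∧ g.BodyHolds S'}

/-- The temporary atoms of a model `S'` of `P` for `S`: those true at the last time point that are
neither in `S` nor the head of a rule of form (1) with true body. -/
def temporary (P : Set (Rule Pred Sym 𝒞)) {n : ℕ} (S S' : FinStream (Atom Pred 𝒞) n) :
    Set (Atom Pred 𝒞) :=
  {a | a ∈ S' (Fin.last n) ∧ a ∉ S (Fin.last n) ∧
    ¬ ∃ g ∈ ground P, g.rule.temp = false ∧ g.BodyHolds S' ∧ g.head = a}

/-- The permanent part of a model `S'` of `P` for `S`. -/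
def permanentPart (P : Set (Rule Pred Sym 𝒞)) {n : ℕ} (S S' : FinStream (Atom Pred 𝒞) n) :
    FinStream (Atom Pred 𝒞) n :=
  Function.update S' (Fin.last n) (S' (Fin.last n) \ temporary P S S')

/-- The stream `⟨S'₀, …, S'ᵢ₋₁, Sᵢ⟩`. -/
def stepInput {A : Type*} {n : ℕ} (S S' : FinStream A n) (i : ℕ) (h : i ≤ n) : FinStream A i :=
  Function.update (S'.restrict i h) (Fin.last i) (S ⟨i, Nat.lt_succ_of_le h⟩)

/-- `S'` is an answer stream of `P` for `S`. -/
def IsAnswerStream (P : Set (Rule Pred Sym 𝒞)) {n : ℕ} (S S' : FinStream (Atom Pred 𝒞) n) : Prop :=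
  S ≤ S' ∧
  (∀ (i : ℕ) (h : i < n), ∃ M : FinStream (Atom Pred 𝒞) i,
    IsMinimalModel (reduct P M) (stepInput S S' i h.le) M ∧
    S'.restrict i h.le = permanentPart P (stepInput S S' i h.le) M) ∧
  IsMinimalModel (reduct P S') (stepInput S S' n le_rfl) S'

/-- `O` is the `t`-bound output stream of `(I, B, P)`. -/
def IsBoundOutput (P : Set (Rule Pred Sym 𝒞)) {n : ℕ} (I : FinStream (Atom Pred 𝒞) n)
    (B : Set (Atom Pred 𝒞)) (t : Fin (n + 1)) (O : FinStream (Atom Pred 𝒞) n) : Prop :=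
  ∃ A : FinStream (Atom Pred 𝒞) t,
    IsAnswerStream (P ∪ facts B) (I.restrict t (Nat.le_of_lt_succ t.isLt)) A ∧
    O = fun (i : Fin (n + 1)) => if h : (i : ℕ) ≤ t then A ⟨i, Nat.lt_succ_of_le h⟩ else ∅

end Semantics

end LDSR

/-! ### LARS -/

namespace LARS

/-- Time terms: natural numbers and time variables; time variables are named by natural numbers. -/
inductive TimeTerm
  | num (k : ℕ)
  | var (u : ℕ)

/-- LARS formulas, with windows `⊞^w` selecting the last `w` time points. -/
inductive Formula (Pred C : Type*)
  | atom (a : Atom Pred (Term C))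
  | neg (α : Formula Pred C)
  | and (α β : Formula Pred C)
  | or (α β : Formula Pred C)
  | imp (α β : Formula Pred C)
  | diamond (α : Formula Pred C)
  | box (α : Formula Pred C)
  | atTime (s : TimeTerm) (α : Formula Pred C)
  | window (w : ℕ) (α : Formula Pred C)
  | triangle (α : Formula Pred C)

/-- Rules `α ← β₁, …, βₘ`. -/
structure Rule (Pred C : Type*) where
  head : Formula Pred C
  body : List (Formula Pred C)

variable {Pred C : Type*}

/-- The time point denoted by a time term. -/
def TimeTerm.value {n : ℕ} (τ : ℕ → Fin (n + 1)) : TimeTerm → ℕ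
  | .num k => k
  | .var u => τ u

/-- The entailment `M, Σ', t ⊩ φ`, where `M` is given by the stream `S` and the background data
`B`, and `φ` is the ground instance of a formula under the substitutions `σ` of constants and `τ`
of time points. The windows keep all atoms at the time points they select, so the substream `Σ'`
is given by its set `T` of time points. -/
def Entails {n : ℕ} (S : FinStream (Atom Pred C) n) (B : Set (Atom Pred C)) (σ : ℕ → C)
    (τ : ℕ → Fin (n + 1)) : Set (Fin (n + 1)) → Fin (n + 1) → Formula Pred C → Prop
  | T, t, .atom a => (t ∈ T ∧ a.subst σ ∈ S t) ∨ a.subst σ ∈ B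
  | T, t, .neg α => ¬ Entails S B σ τ T t α
  | T, t, .and α β => Entails S B σ τ T t α ∧ Entails S B σ τ T t β
  | T, t, .or α β => Entails S B σ τ T t α ∨ Entails S B σ τ T t β
  | T, t, .imp α β => Entails S B σ τ T t α → Entails S B σ τ T t β
  | T, _, .diamond α => ∃ t' ∈ T, Entails S B σ τ T t' α
  | T, _, .box α => ∀ t' ∈ T, Entails S B σ τ T t' α
  | T, _, .atTime s α => ∃ t' ∈ T, (t' : ℕ) = s.value τ ∧ Entails S B σ τ T t' α
  | T, t, .window w α =>
      Entails S B σ τ {i | i ∈ T ∧ i ≤ t ∧ (t : ℕ) ≤ (i : ℕ) + w} t α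
  | _, t, .triangle α => Entails S B σ τ Set.univ t α

/-- A ground instance of a rule: a rule with substitutions of constants for variables and of time
points of a stream for time variables. -/
structure GroundRule (Pred C : Type*) (n : ℕ) where
  rule : Rule Pred C
  σ : ℕ → C
  τ : ℕ → Fin (n + 1)

/-- `M, t ⊨ B(g)`. -/
def GroundRule.BodyHolds {n : ℕ} (S : FinStream (Atom Pred C) n) (B : Set (Atom Pred C))
    (t : Fin (n + 1)) (g : GroundRule Pred C n) : Prop :=
  ∀ β ∈ g.rule.body, Entails S B g.σ g.τ Set.univ t β

/-- `M, t ⊨ H(g)`. -/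
def GroundRule.HeadHolds {n : ℕ} (S : FinStream (Atom Pred C) n) (B : Set (Atom Pred C))
    (t : Fin (n + 1)) (g : GroundRule Pred C n) : Prop :=
  Entails S B g.σ g.τ Set.univ t g.rule.head

/-- The reduct at time `t`, with respect to `S` and `B`, of the grounding of `P`. -/
def reduct (P : Set (Rule Pred C)) {n : ℕ} (S : FinStream (Atom Pred C) n) (B : Set (Atom Pred C))
    (t : Fin (n + 1)) : Set (GroundRule Pred C n) :=
  {g | g.rule ∈ P ∧ g.BodyHolds S B t}

/-- Interpretation streams for `I`. -/
def IsInterpretation (kind : Pred → PredKind) {n : ℕ} (I S : FinStream (Atom Pred C) n) : Prop :=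
  I ≤ S ∧ ∀ i, ∀ a ∈ S i, a ∉ I i → kind a.pred = PredKind.intensional

/-- `S` with background data `B` is a model of a set of ground rules for `I` at time `t`. -/
def IsModel (kind : Pred → PredKind) {n : ℕ} (R : Set (GroundRule Pred C n))
    (I : FinStream (Atom Pred C) n) (B : Set (Atom Pred C)) (t : Fin (n + 1))
    (S : FinStream (Atom Pred C) n) : Prop :=
  IsInterpretation kind I S ∧ ∀ g ∈ R, g.BodyHolds S B t → g.HeadHolds S B t

/-- `S` is an answer stream of `P` for `I` at time `t`, with background data `B`. -/
def IsAnswerStream (kind : Pred → PredKind) (P : Set (Rule Pred C)) {n : ℕ}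
    (I : FinStream (Atom Pred C) n) (B : Set (Atom Pred C)) (t : Fin (n + 1))
    (S : FinStream (Atom Pred C) n) : Prop :=
  IsModel kind (reduct P S B t) I B t S ∧
  ∀ S', IsModel kind (reduct P S B t) I B t S' → ¬ S' < S

/-- `LARS_D`: the finite programs that have, for all input streams and background data, exactly one
answer stream at each time point. -/
def IsDeterministic (kind : Pred → PredKind) (P : Set (Rule Pred C)) : Prop :=
  P.Finite ∧ ∀ (n : ℕ) (I : FinStream (Atom Pred C) n) (B : Set (Atom Pred C)) (t : Fin (n + 1)),
    IsInput kind I → IsBackground kind B → ∃! S, IsAnswerStream kind P I B t S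

/-- `O` is the `t`-bound output stream of `(I, B, P)`. -/
def IsBoundOutput (kind : Pred → PredKind) (P : Set (Rule Pred C)) {n : ℕ}
    (I : FinStream (Atom Pred C) n) (B : Set (Atom Pred C)) (t : Fin (n + 1))
    (O : FinStream (Atom Pred C) n) : Prop :=
  ∃ A, IsAnswerStream kind P I B t A ∧
    O = fun (i : Fin (n + 1)) => if (i : ℕ) ≤ t then A i ∪ B else ∅

end LARS

/-! ### Expressibility -/

/-- `pred(P ∪ I ∪ B)`. -/
def tuplePreds {Pred Sym C : Type*} (P : Set (LDSR.Rule Pred Sym C)) {n : ℕ}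
    (I : FinStream (Atom Pred C) n) (B : Set (Atom Pred C)) : Set Pred :=
  {p | (∃ r ∈ P, p ∈ r.preds) ∨ (∃ i, ∃ a ∈ I i, a.pred = p) ∨ ∃ b ∈ B, b.pred = p}

/-- A fragment `F` of LDSR is bound-expressible via `LARS_D`: there is a mapping `ρ` from `F` to
`LARS_D` such that, for all input streams, background data and evaluation time points `t`, the
`t`-bound outputs of `P ∈ F` and of `ρ P` (which exist and are unique) agree after restriction of
the latter to the predicates of `P`, `I` and `B`. -/
def BoundExpressible {Pred Sym : Type*} [LinearOrder Sym] (kind : Pred → PredKind)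
    (𝒞 : Finset (Value Sym)) (F : Set (Set (LDSR.Rule Pred Sym 𝒞))) : Prop :=
  ∃ ρ : {P // P ∈ F} → {Q : Set (LARS.Rule Pred 𝒞) // LARS.IsDeterministic kind Q},
    ∀ (P : {P // P ∈ F}) (n : ℕ) (I : FinStream (Atom Pred 𝒞) n) (B : Set (Atom Pred 𝒞))
      (t : Fin (n + 1)), IsInput kind I → IsBackground kind B →
      ∃ O O' : FinStream (Atom Pred 𝒞) n,
        (∀ X, LDSR.IsBoundOutput P.1 I B t X ↔ X = O) ∧
        (∀ X, LARS.IsBoundOutput kind (ρ P).1 I B t X ↔ X = O') ∧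
        O = O'.filterPred (tuplePreds P.1 I B)

/-- The fragment `F₄`: the LDSR programs in which all rule heads have intensional predicates. -/
def F4 {Pred Sym : Type*} (kind : Pred → PredKind) (𝒞 : Finset (Value Sym)) :
    Set (Set (LDSR.Rule Pred Sym 𝒞)) :=
  {P | LDSR.IsProgram P ∧ ∀ r ∈ P, kind r.head.pred = PredKind.intensional}

end StreamReasoning

/-! The evaluation of an LDSR program is a chain of minimal models, one per time point, with
temporary atoms erased between steps. A single LARS answer stream can encode the whole chain. Each
ground rule becomes a LARS rule whose time variable `0` ranges over all time points `U`; its head is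
placed at `U` and its body describes the stream up to `U`. The head of a temporary rule is renamed
to a fresh predicate, and renamed atoms are read only by bodies evaluated at the same time point, so
later steps do not see them. The last step of LDSR keeps its temporary atoms, so extra rules copy
renamed atoms back at the evaluation time `t`. Time points after `t` are simulated as well, but the
output discards them.

A body is translated without following its syntax. Its truth depends only on finitely many features:
which of finitely many ground atoms hold at bounded distances from the last time point, and whether
that time point is too early for such a distance to exist (`bodyFunction_features`). Any Boolean
function of these features is a disjunctive normal form, and windows express each feature
(`entails_featureFormula`). Thus counts and aggregates need no separate treatment.

Both semantics then become instances of `RuleSystem`: minimal models of a reduct for rules with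
atomic heads and arbitrary bodies. Stratifying lexicographically by time and predicate level gives
uniqueness and existence (`RuleSystem.IsAnswer.unique`, `RuleSystem.exists_isAnswer`), hence
determinism of the translation. For correctness, `isAnswer_stepModel` shows that the slice of the
LARS answer at each `U` is the minimal model of that step, `permanentPart_stepModel` that dropping
the renamed atoms is the passage to the permanent part, and `stepModel_self` that nothing is lost at
`t`. -/

namespace StreamReasoning

/-! ### Stratified rule systems: existence and uniqueness of answers. -/

/-- A system of rules whose heads are atoms at time points and whose bodies are arbitrary conditions
on streams. -/
structure RuleSystem (A ι : Type*) (n : ℕ) where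
  head : ι → Fin (n + 1) × A
  body : ι → FinStream A n → Prop

namespace RuleSystem

variable {A ι α : Type*} {n : ℕ}

/-- The head of the rule `i` is true in `S`. -/
def HeadIn (R : RuleSystem A ι n) (S : FinStream A n) (i : ι) : Prop :=
  (R.head i).2 ∈ S (R.head i).1

/-- Minimal models of the reduct with respect to themselves, above `E`. -/
def IsAnswer (R : RuleSystem A ι n) (E S : FinStream A n) : Prop :=
  E ≤ S ∧ (∀ i, R.body i S → R.HeadIn S i) ∧
    ∀ Ω, E ≤ Ω → (∀ i, R.body i S → R.body i Ω → R.HeadIn Ω i) → ¬ Ω < S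

/-- Stratification: the body of a rule is monotone in the atoms up to the level of its head and
depends otherwise only on the atoms below that level. -/
def IsStratified [LinearOrder α] (R : RuleSystem A ι n) (lam : Fin (n + 1) → A → α) : Prop :=
  ∀ i S S', R.body i S →
    (∀ k, ∀ x ∈ S k, lam k x ≤ lam (R.head i).1 (R.head i).2 → x ∈ S' k) →
    (∀ k, ∀ x ∈ S' k, lam k x < lam (R.head i).1 (R.head i).2 → x ∈ S k) → R.body i S'

theorem IsAnswer.eq_of_le {R : RuleSystem A ι n} {E S Ω : FinStream A n} (h : R.IsAnswer E S)
    (hle : Ω ≤ S) (hE : E ≤ Ω) (hR : ∀ i, R.body i S → R.body i Ω → R.HeadIn Ω i) : Ω = S :=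
  hle.lt_or_eq.resolve_left (h.2.2 Ω hE hR)

/-- Deleting all unsupported atoms leaves a model of the reduct, so by minimality there are none. -/
theorem IsAnswer.supported {R : RuleSystem A ι n} {E S : FinStream A n} (h : R.IsAnswer E S)
    {k : Fin (n + 1)} {x : A} (hx : x ∈ S k) : x ∈ E k ∨ ∃ i, R.head i = (k, x) ∧ R.body i S := by
  have := h.eq_of_le (Ω := fun k => {x | x ∈ S k ∧ (x ∈ E k ∨ ∃ i, R.head i = (k, x) ∧ R.body i S)})
    (fun k x hx => hx.1) (fun k x hx => ⟨h.1 k hx, Or.inl hx⟩)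
    (fun i hi _ => ⟨h.2.1 i hi, Or.inr ⟨i, rfl, hi⟩⟩)
  rw [← this] at hx
  exact hx.2

section Stratified

variable [LinearOrder α] [WellFoundedLT α] {R : RuleSystem A ι n} {lam : Fin (n + 1) → A → α}

/-- Induction on the level. If two answers agree below `l`, cutting the level-`l` part of one down
to the other leaves a model of its reduct, so minimality gives inclusion; the argument is symmetric.
-/
theorem IsAnswer.unique {E S S' : FinStream A n} (hs : R.IsStratified lam)
    (h : R.IsAnswer E S) (h' : R.IsAnswer E S') : S = S' := by
  have step : ∀ (T T' : FinStream A n) (l : α), R.IsAnswer E T → R.IsAnswer E T' →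
      (∀ k x, lam k x < l → (x ∈ T k ↔ x ∈ T' k)) →
      ∀ k x, lam k x = l → x ∈ T k → x ∈ T' k := by
    intro T T' l hT hT' ih k x hl hx
    -- Levels above `l` are left untouched. Only rules with head at level `l` need an argument, and
    -- their bodies transfer from this stream to `T'` by stratification.
    have := hT.eq_of_le (Ω := fun k => {x | x ∈ T k ∧ (lam k x = l → x ∈ T' k)})
      (fun k x hx => hx.1) (fun k x hx => ⟨hT.1 k hx, fun _ => hT'.1 k hx⟩) (by
        refine fun i hi hi' => ⟨hT.2.1 i hi, fun hil => hT'.2.1 i ?_⟩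
        refine hs i _ _ hi' (fun k x hx hk => ?_) (fun k x hx hk => ?_)
        · rw [hil] at hk
          rcases hk.lt_or_eq with hk | hk
          · exact (ih k x hk).1 hx.1
          · exact hx.2 hk
        · rw [hil] at hk
          exact ⟨(ih k x hk).2 hx, fun e => absurd e hk.ne⟩)
    rw [← this] at hx
    exact hx.2 hl
  have key : ∀ l k x, lam k x = l → (x ∈ S k ↔ x ∈ S' k) := by
    intro l
    induction l using WellFoundedLT.induction with
    | ind l ih =>
      have ih' : ∀ k x, lam k x < l → (x ∈ S k ↔ x ∈ S' k) := fun k x hk => ih _ hk k x rfl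
      exact fun k x hl => ⟨step S S' l h h' ih' k x hl,
        step S' S l h' h (fun k x hk => (ih' k x hk).symm) k x hl⟩
  funext k
  ext x
  exact key _ k x rfl

/-- `Z` is closed under the rules with heads at level `l`, given the set `L` of atoms below. -/
def IsLayer (R : RuleSystem A ι n) (lam : Fin (n + 1) → A → α) (E L : FinStream A n) (l : α)
    (Z : FinStream A n) : Prop :=
  (∀ k, ∀ x ∈ Z k, lam k x = l) ∧ (∀ k, ∀ x ∈ E k, lam k x = l → x ∈ Z k) ∧
    ∀ i, lam (R.head i).1 (R.head i).2 = l → R.body i (L ⊔ Z) → R.HeadIn Z i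

/-- The atoms of level `l` of the answer of a stratified system. -/
noncomputable def layer (R : RuleSystem A ι n) (lam : Fin (n + 1) → A → α) (E : FinStream A n) :
    α → FinStream A n :=
  IsWellFounded.fix (· < ·) fun l prev k =>
    {x | ∀ Z, R.IsLayer lam E (fun k => {x | ∃ l', ∃ h : l' < l, x ∈ prev l' h k}) l Z → x ∈ Z k}

theorem mem_layer {E : FinStream A n} {l : α} {k : Fin (n + 1)} {x : A} :
    x ∈ R.layer lam E l k ↔
      ∀ Z, R.IsLayer lam E (fun k => {x | ∃ l' < l, x ∈ R.layer lam E l' k}) l Z → x ∈ Z k := by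
  rw [layer, IsWellFounded.fix_eq]
  simp only [Set.mem_ofPred_eq, exists_prop]

theorem lam_of_mem_layer {E : FinStream A n} {l : α} {k : Fin (n + 1)} {x : A}
    (h : x ∈ R.layer lam E l k) : lam k x = l :=
  mem_layer.1 h (fun k => {x | lam k x = l}) ⟨fun _ _ h => h, fun _ _ _ h => h, fun _ h _ => h⟩

/-- The answer is the union of the layers, each being the least set closed under the rules of its
level once the lower layers are fixed. -/
theorem exists_isAnswer (hs : R.IsStratified lam) (E : FinStream A n) : ∃ S, R.IsAnswer E S := by
  let S : FinStream A n := fun k => {x | x ∈ R.layer lam E (lam k x) k}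
  let L : α → FinStream A n := fun l k => {x | ∃ l' < l, x ∈ R.layer lam E l' k}
  have hL : ∀ l k x, x ∈ L l k ↔ x ∈ S k ∧ lam k x < l := by
    refine fun l k x => ⟨?_, fun h => ⟨_, h.2, h.1⟩⟩
    rintro ⟨l', hl, hx⟩
    have := lam_of_mem_layer hx
    subst this
    exact ⟨hx, hl⟩
  refine ⟨S, fun k x hx => mem_layer.2 fun Z hZ => hZ.2.1 k x hx rfl, fun i hi => ?_, ?_⟩
  · refine mem_layer.2 fun Z hZ => hZ.2.2 i rfl (hs i _ _ hi ?_ ?_)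
    · intro k x hx hk
      rcases hk.lt_or_eq with hk | hk
      · exact Or.inl ((hL _ k x).2 ⟨hx, hk⟩)
      · refine Or.inr (mem_layer.1 ?_ Z hZ)
        rw [← hk]
        exact hx
    · rintro k x (hx | hx) hk
      · exact ((hL _ k x).1 hx).1
      · exact absurd (hZ.1 k x hx) hk.ne
  · intro Ω hE hΩ hlt
    refine hlt.not_ge ?_
    have key : ∀ l k x, lam k x = l → x ∈ S k → x ∈ Ω k := by
      intro l
      induction l using WellFoundedLT.induction with
      | ind l ih =>
        intro k x hl hx
        subst hl
        -- The level-`l` part of a smaller model `Ω` of the reduct is itself closed, so it contains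
        -- the layer. A body true in this candidate must be moved both to `S`, to lie in the reduct,
        -- and to `Ω`, to fire there.
        refine (mem_layer.1 hx (fun k' => {y | y ∈ Ω k' ∧ lam k' y = lam k x})
          ⟨fun _ _ h => h.2, fun k' y hy hl => ⟨hE k' hy, hl⟩, fun i hil hi => ?_⟩).1
        refine ⟨hΩ i (hs i _ _ hi ?_ ?_) (hs i _ _ hi ?_ ?_), hil⟩
        · rintro k' y (hy | hy) -
          · exact ((hL _ _ _).1 hy).1
          · exact hlt.le k' hy.1
        · exact fun k' y hy hk => Or.inl ((hL _ _ _).2 ⟨hy, hil ▸ hk⟩)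
        · rintro k' y (hy | hy) -
          · exact ih _ ((hL _ _ _).1 hy).2 k' y rfl ((hL _ _ _).1 hy).1
          · exact hy.1
        · exact fun k' y hy hk => Or.inl ((hL _ _ _).2 ⟨hlt.le k' hy, hil ▸ hk⟩)
    exact fun k x hx => key _ k x rfl hx

end Stratified

end RuleSystem

/-! ### LDSR literals as functions of distances to the last time point. -/

namespace LDSR

section Dependence

variable {Pred Sym C : Type*}

/-- The atom `a` holds `d` time points before the last one. -/
def HoldsBefore {A : Type*} {m : ℕ} (S : FinStream A m) (d : ℕ) (a : A) : Prop :=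
  ∃ i : Fin (m + 1), (i : ℕ) + d = m ∧ a ∈ S i

theorem holdsBefore_zero {A : Type*} {m : ℕ} {S : FinStream A m} {a : A} :
    HoldsBefore S 0 a ↔ a ∈ S (Fin.last m) := by
  refine ⟨?_, fun h => ⟨Fin.last m, rfl, h⟩⟩
  rintro ⟨i, hi, h⟩
  rwa [show i = Fin.last m from Fin.ext hi] at h

/-- Counting distances instead of time points makes streams of different lengths comparable. -/
theorem occurrences_eq {m : ℕ} (S : FinStream (Atom Pred C) m) (D : Finset ℕ) (a : Atom Pred C) :
    occurrences S D a = {d | d ∈ D ∧ HoldsBefore S d a}.ncard := by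
  have : {d | d ∈ D ∧ HoldsBefore S d a} =
      (fun i : Fin (m + 1) => m - (i : ℕ)) '' {i | i ∈ backward m D ∧ a ∈ S i} := by
    ext d
    constructor
    · rintro ⟨hd, i, hi, ha⟩
      exact ⟨i, ⟨⟨d, hd, hi⟩, ha⟩, by simp only; omega⟩
    · rintro ⟨i, ⟨⟨d', hd, hi⟩, ha⟩, rfl⟩
      have : m - (i : ℕ) = d' := by omega
      exact ⟨by simpa only [this] using hd, i, by simp only; omega, ha⟩
  rw [this, Set.InjOn.ncard_image]
  · rfl
  · intro i _ j _ h
    simp only at h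
    apply Fin.ext
    omega

/-- The guard `d ≤ m` is why `always` depends on the length of the stream and not only on its atoms.
-/
theorem forall_backward {m : ℕ} (S : FinStream (Atom Pred C) m) (D : Finset ℕ) (a : Atom Pred C) :
    (∀ i ∈ backward m D, a ∈ S i) ↔ ∀ d ∈ D, d ≤ m → HoldsBefore S d a := by
  constructor
  · intro h d hd hm
    exact ⟨⟨m - d, by omega⟩, by simp only; omega, h _ ⟨d, hd, by simp only; omega⟩⟩
  · rintro h i ⟨d, hd, hi⟩
    obtain ⟨j, hj, ha⟩ := h d hd (by omega)
    rwa [show i = j from Fin.ext (by omega)]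

def CondLit.atoms : CondLit Pred Sym C → Set (Atom Pred (Term C))
  | .pos a => {a}
  | .neg a => {a}
  | .builtin _ _ _ => ∅

def AggAtom.atoms (A : AggAtom Pred Sym C) : Set (Atom Pred (Term C)) :=
  {a | ∃ e ∈ A.elems, ∃ c ∈ e.conds, a ∈ c.atoms}

/-- The predicate atoms of a literal. -/
def Lit.atoms : Lit Pred Sym C → Set (Atom Pred (Term C))
  | .pos α => {α.atom}
  | .neg α => {α.atom}
  | .builtin _ _ _ => ∅
  | .agg A => A.atoms
  | .notAgg A => A.atoms

def StreamingAtom.delays : StreamingAtom Pred C → Finset ℕ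
  | .atLeast _ _ D => D.1
  | .always _ D => D.1
  | .count _ _ D => D.1

/-- The distances from the last time point to which a literal refers. -/
def Lit.delays : Lit Pred Sym C → Finset ℕ
  | .pos α => α.delays
  | .neg α => α.delays
  | _ => ∅

theorem CondLit.finite_atoms (c : CondLit Pred Sym C) : c.atoms.Finite := by
  cases c <;> simp [CondLit.atoms]

theorem AggAtom.finite_atoms (A : AggAtom Pred Sym C) : A.atoms.Finite := by
  have : A.atoms = ⋃ e ∈ {e | e ∈ A.elems}, ⋃ c ∈ {c | c ∈ e.conds}, c.atoms := by
    ext; simp [AggAtom.atoms]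
  rw [this]
  exact (List.finite_toSet _).biUnion fun e _ =>
    (List.finite_toSet _).biUnion fun c _ => c.finite_atoms

theorem Lit.finite_atoms (l : Lit Pred Sym C) : l.atoms.Finite := by
  cases l <;> simp [Lit.atoms, AggAtom.finite_atoms]

theorem AggAtom.image_pred_atoms (A : AggAtom Pred Sym C) : Atom.pred '' A.atoms = A.preds := by
  have hc : ∀ c : CondLit Pred Sym C, c.preds = Atom.pred '' c.atoms := by
    intro c
    cases c <;> simp [CondLit.preds, CondLit.atoms]
  ext p
  simp only [AggAtom.atoms, AggAtom.preds, hc, Set.mem_image, Set.mem_ofPred_eq]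
  constructor
  · rintro ⟨a, ⟨e, he, c, hc, ha⟩, rfl⟩
    exact ⟨e, he, c, hc, a, ha, rfl⟩
  · rintro ⟨e, he, c, hc, a, ha, rfl⟩
    exact ⟨a, ⟨e, he, c, hc, ha⟩, rfl⟩

theorem Lit.image_pred_atoms (l : Lit Pred Sym C) :
    Atom.pred '' l.atoms = l.harmlessPreds ∪ l.nonHarmlessPreds := by
  rcases l with (_ | _ | _) | _ | _ | _ | _ <;>
    simp [Lit.atoms, Lit.harmlessPreds, Lit.nonHarmlessPreds, StreamingAtom.atom,
      AggAtom.image_pred_atoms]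

/-- The predicate atoms of a rule. -/
def Rule.atoms (r : Rule Pred Sym C) : Set (Atom Pred (Term C)) :=
  {r.head} ∪ {a | ∃ l ∈ r.body, a ∈ l.atoms}

theorem Rule.finite_atoms (r : Rule Pred Sym C) : r.atoms.Finite := by
  have : {a | ∃ l ∈ r.body, a ∈ l.atoms} = ⋃ l ∈ {l | l ∈ r.body}, l.atoms := by
    ext; simp
  rw [Rule.atoms, this]
  exact (Set.finite_singleton _).union
    ((List.finite_toSet _).biUnion fun l _ => l.finite_atoms)

theorem Rule.image_pred_atoms (r : Rule Pred Sym C) : Atom.pred '' r.atoms = r.preds := by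
  ext p
  simp only [Rule.atoms, Rule.preds, ← Lit.image_pred_atoms, Set.image_union, Set.image_singleton]
  refine or_congr Iff.rfl ⟨?_, ?_⟩
  · rintro ⟨a, ⟨l, hl, ha⟩, rfl⟩
    exact ⟨l, hl, a, ha, rfl⟩
  · rintro ⟨l, hl, a, ha, rfl⟩
    exact ⟨a, ⟨l, hl, ha⟩, rfl⟩

variable {𝒞 : Finset (Value Sym)} {m m' : ℕ} {K : Set (Atom Pred 𝒞)} {N : ℕ}
  {S : FinStream (Atom Pred 𝒞) m} {S' : FinStream (Atom Pred 𝒞) m'}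

theorem StreamingAtom.holds_congr {α : StreamingAtom Pred 𝒞} {σ : ℕ → 𝒞}
    (hm : ∀ d ∈ α.delays, d ≤ m ↔ d ≤ m')
    (h : ∀ d ∈ α.delays,
      HoldsBefore S d (α.atom.subst σ) ↔ HoldsBefore S' d (α.atom.subst σ)) :
    α.Holds S σ ↔ α.Holds S' σ := by
  have occ : occurrences S α.delays (α.atom.subst σ) =
      occurrences S' α.delays (α.atom.subst σ) := by
    rw [occurrences_eq, occurrences_eq]
    congr 1
    ext d
    exact and_congr_right fun hd => h d hd
  rcases α with ⟨a, c, D⟩ | ⟨a, D⟩ | ⟨a, _ | _, D⟩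
  · simp only [StreamingAtom.Holds]
    exact iff_of_eq (congrArg _ occ)
  · simp only [StreamingAtom.Holds, forall_backward]
    exact forall₂_congr fun d hd => imp_congr (hm d hd) (h d hd)
  · simp only [StreamingAtom.Holds]
    exact iff_of_eq (congrArg (· = _) occ)
  · simp only [StreamingAtom.Holds]
    exact iff_of_eq (congrArg (fun k : ℕ => Value.ofInt (k : ℤ) = _) occ)

variable [LinearOrder Sym]

theorem AggAtom.tuples_congr {A : AggAtom Pred Sym 𝒞} {G : Set ℕ} {σ : ℕ → 𝒞}
    (h : ∀ a ∈ A.atoms, ∀ τ : ℕ → 𝒞,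
      a.subst τ ∈ S (Fin.last m) ↔ a.subst τ ∈ S' (Fin.last m')) :
    A.tuples S G σ = A.tuples S' G σ := by
  ext x
  refine exists_congr fun e => and_congr_right fun he => exists_congr fun τ => and_congr_right
    fun _ => and_congr_right fun _ => forall₂_congr fun c hc => ?_
  have : ∀ a ∈ c.atoms, a.subst τ ∈ S (Fin.last m) ↔ a.subst τ ∈ S' (Fin.last m') :=
    fun a ha => h a ⟨e, he, c, hc, ha⟩ τ
  cases c with
  | pos a => exact this a rfl
  | neg a => exact not_congr (this a rfl)
  | builtin t op u => exact Iff.rfl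

/-- Harmless literals are monotone in their atoms, all others need exact agreement. Allowing two
lengths lets the same lemma serve stratification (equal lengths) and the reduction to features. -/
theorem Lit.Holds.mono {l : Lit Pred Sym 𝒞} {G : Set ℕ} {σ : ℕ → 𝒞} (hl : l.Holds S G σ)
    (hK : ∀ a ∈ l.atoms, ∀ τ : ℕ → 𝒞, a.subst τ ∈ K) (hN : ∀ d ∈ l.delays, d ≤ N)
    (hm : ∀ d ≤ N, d ≤ m ↔ d ≤ m')
    (h₁ : ∀ d ≤ N, ∀ a ∈ K, a.pred ∈ l.harmlessPreds → HoldsBefore S d a → HoldsBefore S' d a)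
    (h₂ : ∀ d ≤ N, ∀ a ∈ K, a.pred ∈ l.nonHarmlessPreds →
      (HoldsBefore S d a ↔ HoldsBefore S' d a)) :
    l.Holds S' G σ := by
  have hagg : ∀ A : AggAtom Pred Sym 𝒞, A.atoms = l.atoms → A.preds = l.nonHarmlessPreds →
      A.tuples S G σ = A.tuples S' G σ := by
    intro A e e'
    refine AggAtom.tuples_congr fun a ha τ => ?_
    rw [← holdsBefore_zero, ← holdsBefore_zero]
    refine h₂ 0 N.zero_le _ (hK a (e ▸ ha) τ) ?_
    rw [← e', ← AggAtom.image_pred_atoms]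
    exact ⟨a, ha, rfl⟩
  cases l with
  | pos α =>
    rcases α with ⟨a, c, D⟩ | ⟨a, D⟩ | ⟨a, t, D⟩
    · refine le_trans (b := occurrences S D.1 (a.subst σ)) hl ?_
      rw [occurrences_eq, occurrences_eq]
      exact Set.ncard_le_ncard
        (fun d hd => ⟨hd.1, h₁ d (hN d hd.1) _ (hK a rfl σ) rfl hd.2⟩)
        (D.1.finite_toSet.subset fun d hd => hd.1)
    · have hl : ∀ i ∈ backward m D.1, a.subst σ ∈ S i := hl
      show ∀ i ∈ backward m' D.1, a.subst σ ∈ S' i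
      rw [forall_backward] at hl ⊢
      exact fun d hd hm' => h₁ d (hN d hd) _ (hK a rfl σ) rfl
        (hl d hd ((hm d (hN d hd)).2 hm'))
    · exact (StreamingAtom.holds_congr (fun d hd => hm d (hN d hd))
        fun d hd => h₂ d (hN d hd) _ (hK a rfl σ) rfl).1 hl
  | neg α =>
    exact (not_congr (StreamingAtom.holds_congr (fun d hd => hm d (hN d hd))
      fun d hd => h₂ d (hN d hd) _ (hK _ rfl σ) rfl)).1 hl
  | builtin t op u => exact hl
  | agg A =>
    obtain ⟨u, hu, h⟩ := hl
    exact ⟨u, hu, hagg A rfl rfl ▸ h⟩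
  | notAgg A =>
    obtain ⟨u, hu, h⟩ := hl
    exact ⟨u, hu, hagg A rfl rfl ▸ h⟩

end Dependence

/-! ### Supports, predicate levels and uniqueness for LDSR programs. -/

section Programs

variable {Pred Sym : Type*} {𝒞 : Finset (Value Sym)}

/-- The predicates that occur in a program. -/
def progPreds (P : Set (Rule Pred Sym 𝒞)) : Set Pred := {p | ∃ r ∈ P, p ∈ r.preds}

/-- `K` and `N` bound the ground atoms and the distances to which a program refers. -/
structure IsSupport (P : Set (Rule Pred Sym 𝒞)) (K : Set (Atom Pred 𝒞)) (N : ℕ) : Prop where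
  finite : K.Finite
  pred_mem : ∀ a ∈ K, a.pred ∈ progPreds P
  atom_mem : ∀ r ∈ P, ∀ a ∈ r.atoms, ∀ τ : ℕ → 𝒞, a.subst τ ∈ K
  delay_le : ∀ r ∈ P, ∀ l ∈ r.body, ∀ d ∈ l.delays, d ≤ N

theorem finite_progPreds {P : Set (Rule Pred Sym 𝒞)} (hP : P.Finite) : (progPreds P).Finite := by
  have : progPreds P = ⋃ r ∈ P, Atom.pred '' r.atoms := by
    ext; simp [progPreds, ← Rule.image_pred_atoms]
  rw [this]
  exact hP.biUnion fun r _ => r.finite_atoms.image _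

theorem exists_isSupport {P : Set (Rule Pred Sym 𝒞)} (hP : P.Finite) :
    ∃ K N, IsSupport P K N := by
  have hN : (⋃ r ∈ P, ⋃ l ∈ {l | l ∈ r.body}, (l.delays : Set ℕ)).Finite :=
    hP.biUnion fun r _ => (List.finite_toSet _).biUnion fun l _ => l.delays.finite_toSet
  obtain ⟨N, hN⟩ := hN.bddAbove
  -- Substitutions are infinitely many, but an instance of an atom is determined by an argument list
  -- of fixed length over the finite set of constants.
  refine ⟨⋃ r ∈ P, ⋃ a ∈ r.atoms, Set.range fun τ : ℕ → 𝒞 => a.subst τ, N, ?_, ?_, ?_, ?_⟩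
  · refine hP.biUnion fun r _ => r.finite_atoms.biUnion fun a _ => ?_
    refine ((List.finite_length_eq 𝒞 a.args.length).image (Atom.mk a.pred)).subset ?_
    rintro _ ⟨τ, rfl⟩
    exact ⟨a.args.map (Term.subst τ), by simp, rfl⟩
  · intro a ha
    simp only [Set.mem_iUnion, Set.mem_range] at ha
    obtain ⟨r, hr, a', ha', τ, rfl⟩ := ha
    refine ⟨r, hr, ?_⟩
    rw [← Rule.image_pred_atoms]
    exact ⟨a', ha', rfl⟩
  · intro r hr a ha τ
    exact Set.mem_biUnion hr (Set.mem_biUnion ha ⟨τ, rfl⟩)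
  · intro r hr l hl d hd
    exact hN (Set.mem_biUnion hr (Set.mem_biUnion (show l ∈ {l | l ∈ r.body} from hl) hd))

/-- A stratification of the predicates: predicates without rules may have level `0`. -/
def IsLevel (P : Set (Rule Pred Sym 𝒞)) (lam : Pred → ℕ) : Prop :=
  ∀ r ∈ P, ∀ l ∈ r.body, (∀ p ∈ l.harmlessPreds, lam p ≤ lam r.head.pred) ∧
    ∀ p ∈ l.nonHarmlessPreds, lam p < lam r.head.pred

theorem Stratified.exists_isLevel {P : Set (Rule Pred Sym 𝒞)} (hP : P.Finite)
    (h : Stratified P) : ∃ lam, IsLevel P lam := by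
  classical
  obtain ⟨level, hlevel⟩ := h
  -- The shift by one keeps every head predicate above level `0`, so predicates without rules, on
  -- which the given stratification imposes nothing, lie strictly below it.
  let lam : Pred → ℕ := fun p =>
    (hP.toFinset.filter fun r => r.head.pred = p).sup fun r => level r + 1
  have hle : ∀ r ∈ P, level r + 1 ≤ lam r.head.pred := fun r hr =>
    Finset.le_sup (f := fun r => level r + 1) (by simpa using hr)
  refine ⟨lam, fun r hr l hl => ⟨fun p hp => ?_, fun p hp => ?_⟩⟩
  · refine le_trans (Finset.sup_le fun r' hr' => ?_) (hle r hr)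
    simp only [Finset.mem_filter, Set.Finite.mem_toFinset] at hr'
    exact Nat.succ_le_succ ((hlevel r hr l hl r' hr'.1).1 (hr'.2 ▸ hp))
  · refine lt_of_lt_of_le (Nat.lt_succ_of_le (Finset.sup_le fun r' hr' => ?_)) (hle r hr)
    simp only [Finset.mem_filter, Set.Finite.mem_toFinset] at hr'
    exact (hlevel r hr l hl r' hr'.1).2 (hr'.2 ▸ hp)

theorem mem_ground_union_facts {P : Set (Rule Pred Sym 𝒞)} {B : Set (Atom Pred 𝒞)}
    {g : GroundRule Pred 𝒞}
    (hg : g ∈ ground (P ∪ facts B)) : g ∈ ground P ∨ g.head ∈ B ∧ g.rule.body = [] := by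
  obtain ⟨hr | ⟨b, hb, hr⟩, hv⟩ := hg
  · exact Or.inl ⟨hr, hv⟩
  · refine Or.inr ⟨?_, by rw [hr]⟩
    have : g.head = b := by
      simp [GroundRule.head, hr, Atom.subst, Term.subst, Function.comp_def]
    rwa [this]

theorem exists_fact (h𝒞 : 𝒞.Nonempty) (P : Set (Rule Pred Sym 𝒞)) {B : Set (Atom Pred 𝒞)}
    {b : Atom Pred 𝒞} (hb : b ∈ B) :
    ∃ g ∈ ground (P ∪ facts B), g.head = b ∧ g.rule.temp = false ∧ g.rule.body = [] := by
  refine ⟨⟨⟨false, ⟨b.pred, b.args.map Term.const⟩, []⟩, fun _ => ⟨_, h𝒞.choose_spec⟩⟩,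
    ⟨Or.inr ⟨b, hb, rfl⟩, by simp⟩, ?_, rfl, rfl⟩
  simp [GroundRule.head, Atom.subst, Term.subst, Function.comp_def]

variable [LinearOrder Sym] {P : Set (Rule Pred Sym 𝒞)} {K : Set (Atom Pred 𝒞)} {N : ℕ}
  {m m' : ℕ} {S : FinStream (Atom Pred 𝒞) m} {S' : FinStream (Atom Pred 𝒞) m'}

theorem GroundRule.BodyHolds.mono (hK : IsSupport P K N) {lam : Pred → ℕ} (hlam : IsLevel P lam)
    {g : GroundRule Pred 𝒞} (hg : g.rule ∈ P) (h : g.BodyHolds S)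
    (hm : ∀ d ≤ N, d ≤ m ↔ d ≤ m')
    (h₁ : ∀ d ≤ N, ∀ a ∈ K, lam a.pred ≤ lam g.head.pred →
      HoldsBefore S d a → HoldsBefore S' d a)
    (h₂ : ∀ d ≤ N, ∀ a ∈ K, lam a.pred < lam g.head.pred →
      HoldsBefore S' d a → HoldsBefore S d a) : g.BodyHolds S' := by
  intro l hl
  refine (h l hl).mono (fun a ha => hK.atom_mem _ hg a (Or.inr ⟨l, hl, ha⟩))
    (hK.delay_le _ hg l hl) hm (fun d hd a ha hp => ?_) (fun d hd a ha hp => ?_)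
  · exact h₁ d hd a ha ((hlam _ hg l hl).1 _ hp)
  · have := (hlam _ hg l hl).2 _ hp
    exact ⟨h₁ d hd a ha this.le, h₂ d hd a ha this⟩

theorem GroundRule.BodyHolds.congr (hK : IsSupport P K N)
    {g : GroundRule Pred 𝒞} (hg : g.rule ∈ P) (h : g.BodyHolds S)
    (hm : ∀ d ≤ N, d ≤ m ↔ d ≤ m')
    (h₁ : ∀ d ≤ N, ∀ a ∈ K, HoldsBefore S d a ↔ HoldsBefore S' d a) : g.BodyHolds S' := by
  intro l hl
  exact (h l hl).mono (fun a ha => hK.atom_mem _ hg a (Or.inr ⟨l, hl, ha⟩))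
    (hK.delay_le _ hg l hl) hm (fun d hd a ha _ => (h₁ d hd a ha).1)
    (fun d hd a ha _ => h₁ d hd a ha)

/-- The rule system of a step of the evaluation of `P`. -/
def stepSystem (P : Set (Rule Pred Sym 𝒞)) (m : ℕ) :
    RuleSystem (Atom Pred 𝒞) {g : GroundRule Pred 𝒞 // g ∈ ground P} m where
  head g := (Fin.last m, g.1.head)
  body g S := g.1.BodyHolds S

theorem isMinimalModel_reduct_iff {S M : FinStream (Atom Pred 𝒞) m} :
    IsMinimalModel (reduct P M) S M ↔ (stepSystem P m).IsAnswer S M := by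
  constructor
  · rintro ⟨⟨h₁, h₂⟩, h₃⟩
    refine ⟨h₁, fun g hg => h₂ g.1 ⟨g.2, hg⟩ hg, fun Ω hE hΩ => h₃ Ω ⟨hE, fun g hg hb => ?_⟩⟩
    exact hΩ ⟨g, hg.1⟩ hg.2 hb
  · rintro ⟨h₁, h₂, h₃⟩
    refine ⟨⟨h₁, fun g hg hb => h₂ ⟨g, hg.1⟩ hb⟩, fun Ω hΩ => h₃ Ω hΩ.1 fun g hg hb => ?_⟩
    exact hΩ.2 g.1 ⟨g.2, hg⟩ hb

/-- All heads sit at the last time point, so earlier atoms are strictly lower in the lexicographic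
order and may occur in any way; predicate levels decide only at the last time point. -/
theorem stepSystem_isStratified (hK : IsSupport P K N) {lam : Pred → ℕ} (hlam : IsLevel P lam)
    (B : Set (Atom Pred 𝒞)) (m : ℕ) :
    (stepSystem (P ∪ facts B) m).IsStratified fun k a => toLex (k, lam a.pred) := by
  rintro ⟨g, hg⟩ S S' h h₁ h₂
  rcases mem_ground_union_facts hg with hg' | hg'
  · refine GroundRule.BodyHolds.mono hK hlam hg'.1 h (fun d _ => Iff.rfl) ?_ ?_
    · rintro d - a - hl ⟨i, hi, ha⟩
      refine ⟨i, hi, h₁ i a ha ?_⟩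
      rw [Prod.Lex.toLex_le_toLex]
      rcases (Fin.le_last i).lt_or_eq with h | h
      · exact Or.inl h
      · exact Or.inr ⟨h, hl⟩
    · rintro d - a - hl ⟨i, hi, ha⟩
      refine ⟨i, hi, h₂ i a ha ?_⟩
      rw [Prod.Lex.toLex_lt_toLex]
      rcases (Fin.le_last i).lt_or_eq with h | h
      · exact Or.inl h
      · exact Or.inr ⟨h, hl⟩
  · intro l hl
    change l ∈ g.rule.body at hl
    simp [hg'.2] at hl

/-- Equal prefixes give equal step inputs, hence equal minimal models and equal permanent parts; the
final step is compared last. -/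
theorem IsAnswerStream.unique (hK : IsSupport P K N) {lam : Pred → ℕ} (hlam : IsLevel P lam)
    {B : Set (Atom Pred 𝒞)} {n : ℕ} {I S S' : FinStream (Atom Pred 𝒞) n}
    (h : IsAnswerStream (P ∪ facts B) I S) (h' : IsAnswerStream (P ∪ facts B) I S') : S = S' := by
  have step : ∀ (i : ℕ) (hi : i ≤ n), (∀ (j : ℕ) (hj : j < i),
      S ⟨j, by omega⟩ = S' ⟨j, by omega⟩) → stepInput I S i hi = stepInput I S' i hi := by
    intro i hi hj
    funext k
    rcases eq_or_ne k (Fin.last i) with rfl | hk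
    · simp [stepInput]
    · simp only [stepInput, Function.update_of_ne hk, FinStream.restrict]
      exact hj k (Fin.lt_last_iff_ne_last.2 hk)
  have uniq : ∀ {m : ℕ} {E M M' : FinStream (Atom Pred 𝒞) m},
      IsMinimalModel (reduct (P ∪ facts B) M) E M →
      IsMinimalModel (reduct (P ∪ facts B) M') E M' → M = M' := fun hM hM' =>
    RuleSystem.IsAnswer.unique (stepSystem_isStratified hK hlam B _)
      (isMinimalModel_reduct_iff.1 hM) (isMinimalModel_reduct_iff.1 hM')
  have key : ∀ (i : ℕ) (hi : i < n), S ⟨i, by omega⟩ = S' ⟨i, by omega⟩ := by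
    intro i
    induction i using Nat.strong_induction_on with
    | _ i ih =>
      intro hi
      obtain ⟨M, hM, e⟩ := h.2.1 i hi
      obtain ⟨M', hM', e'⟩ := h'.2.1 i hi
      rw [← step i hi.le fun j hj => ih j hj (by omega)] at hM' e'
      rw [← uniq hM hM', ← e] at e'
      exact (congrFun e' (Fin.last i)).symm
  have e := step n le_rfl key
  have h3 := h'.2.2
  rw [← e] at h3
  exact uniq h.2.2 h3

end Programs

end LDSR

/-! ### LARS formulas for Boolean combinations, distances and delayed atoms. -/

/-- A ground atom as an atom of a program. -/
def Atom.lift {Pred C : Type*} (a : Atom Pred C) : Atom Pred (Term C) :=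
  ⟨a.pred, a.args.map Term.const⟩

theorem Atom.subst_lift {Pred C : Type*} (σ : ℕ → C) (a : Atom Pred C) : a.lift.subst σ = a := by
  simp [Atom.lift, Atom.subst, Term.subst, Function.comp_def]

/-- Replace the predicate of an atom. -/
def Atom.rename {Pred C : Type*} (f : Pred → Pred) (a : Atom Pred C) : Atom Pred C :=
  ⟨f a.pred, a.args⟩

theorem Atom.rename_injOn {Pred C : Type*} {f : Pred → Pred} {s : Set Pred} (hf : s.InjOn f) :
    {a : Atom Pred C | a.pred ∈ s}.InjOn (Atom.rename f) := by
  rintro ⟨p, x⟩ hp ⟨q, y⟩ hq h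
  simp only [Atom.rename, Atom.mk.injEq] at h
  rw [Atom.mk.injEq]
  exact ⟨hf hp hq h.1, h.2⟩

namespace LARS

section Formulas

variable {Pred C : Type*}

namespace Formula

def top (p : Pred) : Formula Pred C := .imp (.atom ⟨p, []⟩) (.atom ⟨p, []⟩)

def all (p : Pred) (L : List (Formula Pred C)) : Formula Pred C := L.foldr .and (top p)

def any (p : Pred) (L : List (Formula Pred C)) : Formula Pred C := L.foldr .or (.neg (top p))

open Classical in
/-- The disjunctive normal form over the formulas `φ j` with the truth function `Φ`. -/
noncomputable def dnf {J : Type*} [Finite J] (p : Pred) (φ : J → Formula Pred C)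
    (Φ : Set J → Prop) : Formula Pred C :=
  letI := Fintype.ofFinite J
  any p ((Finset.univ.filter Φ).toList.map fun Y =>
    all p (Finset.univ.toList.map fun j => if j ∈ Y then φ j else .neg (φ j)))

/-- The time variable `d + 1` lies `d + 1` time points before the time variable `0`. -/
def isBefore (p : Pred) (d : ℕ) : Formula Pred C :=
  .atTime (.var 0) (.and (.window (d + 1) (.atTime (.var (d + 1)) (top p)))
    (.neg (.window d (.atTime (.var (d + 1)) (top p)))))

/-- The time variable `0` is at most `d`. -/
def isEarly (p : Pred) (d : ℕ) : Formula Pred C :=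
  .atTime (.var 0) (.window d (.atTime (.num 0) (top p)))

/-- The ground atom `a` holds at the time variable `u`. -/
def atVar (u : ℕ) (a : Atom Pred C) : Formula Pred C := .atTime (.var u) (.atom a.lift)

/-- The ground atom `a`, or for `d = 0` its renaming, holds `d` time points before the time
variable `0`. -/
def before (p : Pred) (aux : Pred → Pred) : ℕ → Atom Pred C → Formula Pred C
  | 0, a => .or (atVar 0 a) (atVar 0 (a.rename aux))
  | d + 1, a => .and (isBefore p d) (atVar (d + 1) a)

end Formula

variable {n : ℕ} {S : FinStream (Atom Pred C) n} {B : Set (Atom Pred C)} {σ : ℕ → C}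
  {τ : ℕ → Fin (n + 1)} {T : Set (Fin (n + 1))} {t : Fin (n + 1)}

theorem entails_top {p : Pred} : Entails S B σ τ T t (.top p) := by
  simp [Formula.top, Entails]

theorem entails_all {p : Pred} {L : List (Formula Pred C)} :
    Entails S B σ τ T t (.all p L) ↔ ∀ φ ∈ L, Entails S B σ τ T t φ := by
  induction L with
  | nil => simp [Formula.all, entails_top]
  | cons φ L ih =>
    simp only [Formula.all, List.foldr_cons, Entails] at ih ⊢
    simp [ih]

theorem entails_any {p : Pred} {L : List (Formula Pred C)} :
    Entails S B σ τ T t (.any p L) ↔ ∃ φ ∈ L, Entails S B σ τ T t φ := by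
  induction L with
  | nil => simp [Formula.any, entails_top, Entails]
  | cons φ L ih =>
    simp only [Formula.any, List.foldr_cons, Entails] at ih ⊢
    simp [ih]

theorem entails_dnf {J : Type*} [Finite J] {p : Pred} {φ : J → Formula Pred C}
    {Φ : Set J → Prop} :
    Entails S B σ τ T t (.dnf p φ Φ) ↔ Φ {j | Entails S B σ τ T t (φ j)} := by
  classical
  have key : ∀ Y : Set J, (∀ j, Entails S B σ τ T t (if j ∈ Y then φ j else .neg (φ j))) ↔
      {j | Entails S B σ τ T t (φ j)} = Y := by
    intro Y
    rw [Set.ext_iff]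
    refine forall_congr' fun j => ?_
    by_cases hj : j ∈ Y <;> simp [hj, Entails]
  simp only [Formula.dnf, entails_any, List.mem_map, Finset.mem_toList, Finset.mem_filter,
    Finset.mem_univ, true_and]
  constructor
  · rintro ⟨_, ⟨Y, hY, rfl⟩, h⟩
    have : {j | Entails S B σ τ T t (φ j)} = Y :=
      (key Y).1 fun j => entails_all.1 h _ (List.mem_map.2 ⟨j, by simp, rfl⟩)
    rwa [this]
  · intro h
    refine ⟨_, ⟨_, h, rfl⟩, entails_all.2 fun ψ hψ => ?_⟩
    obtain ⟨j, -, rfl⟩ := List.mem_map.1 hψ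
    exact (key _).2 rfl j

theorem entails_atTime_var {u : ℕ} {φ : Formula Pred C} :
    Entails S B σ τ T t (.atTime (.var u) φ) ↔ τ u ∈ T ∧ Entails S B σ τ T (τ u) φ := by
  simp only [Entails, TimeTerm.value]
  constructor
  · rintro ⟨t', h, e, h'⟩
    obtain rfl := Fin.ext e
    exact ⟨h, h'⟩
  · rintro ⟨h, h'⟩
    exact ⟨_, h, rfl, h'⟩

theorem entails_atVar {u : ℕ} {a : Atom Pred C} :
    Entails S B σ τ Set.univ t (.atVar u a) ↔ a ∈ S (τ u) ∨ a ∈ B := by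
  simp [Formula.atVar, entails_atTime_var, Entails, Atom.subst_lift]

/-- A time point in the window of width `d + 1` but not in that of width `d` lies at distance
exactly `d + 1`. -/
theorem entails_isBefore {p : Pred} {d : ℕ} :
    Entails S B σ τ Set.univ t (.isBefore p d) ↔ (τ (d + 1) : ℕ) + (d + 1) = τ 0 := by
  simp only [Formula.isBefore, entails_atTime_var, Entails, entails_top, Set.mem_univ,
    Set.mem_ofPred_eq, true_and, and_true, Fin.le_def, TimeTerm.value]
  constructor
  · rintro ⟨⟨t', ⟨h₁, h₂⟩, e⟩, h⟩
    by_contra hne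
    exact h ⟨t', ⟨h₁, by omega⟩, e⟩
  · refine fun h => ⟨⟨τ (d + 1), ⟨by omega, by omega⟩, rfl⟩, ?_⟩
    rintro ⟨t', ⟨h₁, h₂⟩, e⟩
    omega

theorem entails_isEarly {p : Pred} {d : ℕ} :
    Entails S B σ τ Set.univ t (.isEarly p d) ↔ (τ 0 : ℕ) ≤ d := by
  simp only [Formula.isEarly, entails_atTime_var, Entails, entails_top, Set.mem_univ,
    Set.mem_ofPred_eq, true_and, and_true, Fin.le_def, TimeTerm.value]
  constructor
  · rintro ⟨t', ⟨-, h⟩, e⟩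
    omega
  · exact fun h => ⟨0, ⟨Nat.zero_le _, by simpa using h⟩, rfl⟩

end Formulas

/-- The stream up to `U` with the background data, where the renamed atoms count at `U`. -/
def history {Pred C : Type*} {n : ℕ} (aux : Pred → Pred) (B : Set (Atom Pred C)) (U : Fin (n + 1))
    (S : FinStream (Atom Pred C) n) : FinStream (Atom Pred C) U :=
  fun i => {a | a ∈ S (Fin.castLE U.isLt i) ∨ a ∈ B ∨ (i : ℕ) = U ∧ a.rename aux ∈ S U}

section History

variable {Pred C : Type*} {n : ℕ} {aux : Pred → Pred} {B : Set (Atom Pred C)} {U : Fin (n + 1)}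
  {S : FinStream (Atom Pred C) n} {a : Atom Pred C}

theorem holdsBefore_zero_history :
    LDSR.HoldsBefore (history aux B U S) 0 a ↔ (a ∈ S U ∨ a.rename aux ∈ S U) ∨ a ∈ B := by
  rw [LDSR.holdsBefore_zero]
  have : Fin.castLE U.isLt (Fin.last U) = U := rfl
  simp only [history, this, Set.mem_ofPred_eq, Fin.val_last, true_and]
  tauto

theorem holdsBefore_succ_history {d : ℕ} {V : Fin (n + 1)} (h : (V : ℕ) + (d + 1) = U) :
    LDSR.HoldsBefore (history aux B U S) (d + 1) a ↔ a ∈ S V ∨ a ∈ B := by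
  constructor
  · rintro ⟨i, hi, ha | ha | ⟨hi', -⟩⟩
    · rw [show Fin.castLE U.isLt i = V from Fin.ext (by simp; omega)] at ha
      exact Or.inl ha
    · exact Or.inr ha
    · omega
  · intro ha
    refine ⟨⟨V, by omega⟩, h, ?_⟩
    exact ha.imp id Or.inl

end History

/-! ### The translation and its rule system. -/

section Translation

variable {Pred Sym : Type*} {𝒞 : Finset (Value Sym)}

/-- The facts on which the truth of a body depends: atoms `d ≤ N` time points before the last one,
and comparisons of the last time point with `d ≤ N`. -/
abbrev Feature (K : Set (Atom Pred 𝒞)) (N : ℕ) := (Fin (N + 1) × K) ⊕ Fin (N + 1)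

/-- The features of a stream. -/
def features (K : Set (Atom Pred 𝒞)) (N : ℕ) {m : ℕ} (S : FinStream (Atom Pred 𝒞) m) :
    Set (Feature K N) :=
  {j | Sum.elim (fun x => LDSR.HoldsBefore S x.1 x.2.1) (fun d => m ≤ d) j}

/-- The names `aux p` are new, intensional, and distinct for the predicates of `P`. -/
structure IsAux (kind : Pred → PredKind) (P : Set (LDSR.Rule Pred Sym 𝒞)) (aux : Pred → Pred) :
    Prop where
  injOn : (LDSR.progPreds P).InjOn aux
  kind_eq : ∀ p, kind (aux p) = PredKind.intensional
  notMem : ∀ p, aux p ∉ LDSR.progPreds P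

/-- The head of the translation of a ground rule. -/
def headAtom (aux : Pred → Pred) (g : LDSR.GroundRule Pred 𝒞) : Atom Pred 𝒞 :=
  if g.rule.temp then g.head.rename aux else g.head

theorem head_mem {P : Set (LDSR.Rule Pred Sym 𝒞)} {K : Set (Atom Pred 𝒞)} {N : ℕ}
    (hK : LDSR.IsSupport P K N) {g : LDSR.GroundRule Pred 𝒞}
    (hg : g ∈ LDSR.ground P) : g.head ∈ K :=
  hK.atom_mem _ hg.1 _ (Or.inl rfl) _

theorem kind_headAtom {kind : Pred → PredKind} {P : Set (LDSR.Rule Pred Sym 𝒞)}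
    {aux : Pred → Pred} (haux : IsAux kind P aux)
    (hhead : ∀ r ∈ P, kind r.head.pred = PredKind.intensional) {g : LDSR.GroundRule Pred 𝒞}
    (hg : g ∈ LDSR.ground P) : kind (headAtom aux g).pred = PredKind.intensional := by
  unfold headAtom
  split_ifs
  · exact haux.kind_eq _
  · exact hhead _ hg.1

theorem notMem_background {kind : Pred → PredKind} {B : Set (Atom Pred 𝒞)}
    (hB : IsBackground kind B) {a : Atom Pred 𝒞}
    (ha : kind a.pred = PredKind.intensional) : a ∉ B := by
  intro h
  have := hB a h
  rw [ha] at this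
  cases this

/-- The formula that expresses a feature, relative to the time variable `0`. -/
def featureFormula (p : Pred) (aux : Pred → Pred) {K : Set (Atom Pred 𝒞)} {N : ℕ} :
    Feature K N → Formula Pred 𝒞 :=
  Sum.elim (fun x => .before p aux x.1 x.2.1) (fun d => .isEarly p d)

/-- The rule by which the temporary atoms are added at the time of evaluation. -/
def copyRule (aux : Pred → Pred) (a : Atom Pred 𝒞) : Rule Pred 𝒞 :=
  ⟨.atom a.lift, [.atom (a.rename aux).lift]⟩

variable {kind : Pred → PredKind} {p : Pred} {aux : Pred → Pred}
  {P : Set (LDSR.Rule Pred Sym 𝒞)} {K : Set (Atom Pred 𝒞)} {N : ℕ} {B : Set (Atom Pred 𝒞)} {n : ℕ}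
  {t : Fin (n + 1)} {S : FinStream (Atom Pred 𝒞) n}

/-- The hypothesis on `τ` forces variable `d + 1` to be the time point at that distance whenever one
exists. Otherwise the conjunct `isBefore` fails, as does the feature. -/
theorem entails_featureFormula (haux : IsAux kind P aux) (hB : IsBackground kind B) {σ : ℕ → 𝒞}
    {τ : ℕ → Fin (n + 1)} (hτ : ∀ d < N, (τ (d + 1) : ℕ) + (d + 1) = τ 0 ∨ (τ 0 : ℕ) ≤ d) :
    {j : Feature K N | Entails S B σ τ Set.univ t (featureFormula p aux j)} =
      features K N (history aux B (τ 0) S) := by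
  ext j
  rcases j with ⟨⟨d, hd⟩, a⟩ | d
  · show Entails S B σ τ Set.univ t (.before p aux d a.1) ↔
      LDSR.HoldsBefore (history aux B (τ 0) S) d a.1
    rcases d with _ | d
    · have : a.1.rename aux ∉ B := notMem_background hB (haux.kind_eq _)
      simp only [Formula.before, Entails, entails_atVar, holdsBefore_zero_history]
      tauto
    · simp only [Formula.before, Entails, entails_atVar, entails_isBefore]
      rcases hτ d (by omega) with h | h
      · rw [holdsBefore_succ_history h]
        exact and_iff_right h
      · refine iff_of_false (fun h' => by omega) ?_
        rintro ⟨i, hi, -⟩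
        omega
  · exact entails_isEarly (t := t)

theorem bodyHolds_copyRule (hB : IsBackground kind B) (haux : IsAux kind P aux)
    {a : Atom Pred 𝒞} {σ : ℕ → 𝒞} {τ : ℕ → Fin (n + 1)} :
    GroundRule.BodyHolds S B t ⟨copyRule aux a, σ, τ⟩ ↔ a.rename aux ∈ S t := by
  have : a.rename aux ∉ B := notMem_background hB (haux.kind_eq _)
  simp [GroundRule.BodyHolds, copyRule, Entails, Atom.subst_lift, this]

variable [LinearOrder Sym]

/-- The truth of the body of a ground rule as a function of the features. -/
def bodyFunction (K : Set (Atom Pred 𝒞)) (N : ℕ) (g : LDSR.GroundRule Pred 𝒞)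
    (Y : Set (Feature K N)) : Prop :=
  ∃ (m : ℕ) (S : FinStream (Atom Pred 𝒞) m), features K N S = Y ∧ g.BodyHolds S

/-- Streams with the same features satisfy the same bodies, so the witness in `bodyFunction` does
not matter. The comparisons `m ≤ d` tell which distances exceed the length. -/
theorem bodyFunction_features {P : Set (LDSR.Rule Pred Sym 𝒞)} {K : Set (Atom Pred 𝒞)} {N : ℕ}
    (hK : LDSR.IsSupport P K N) {g : LDSR.GroundRule Pred 𝒞} (hg : g.rule ∈ P) {m : ℕ}
    {S : FinStream (Atom Pred 𝒞) m} : bodyFunction K N g (features K N S) ↔ g.BodyHolds S := by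
  refine ⟨?_, fun h => ⟨m, S, rfl, h⟩⟩
  rintro ⟨m', S', e, h⟩
  rw [Set.ext_iff] at e
  refine h.congr hK hg (fun d hd => ?_) fun d hd a ha => ?_
  · rcases d with _ | d
    · simp
    · have : m' ≤ d ↔ m ≤ d := e (Sum.inr ⟨d, by omega⟩)
      omega
  · exact e (Sum.inl (⟨d, by omega⟩, ⟨a, ha⟩))

/-- The rule for the head `x` and the truth function `Φ`. -/
noncomputable def ruleOf (p : Pred) (aux : Pred → Pred) (K : Set (Atom Pred 𝒞)) [Finite K] (N : ℕ)
    (x : Atom Pred 𝒞) (Φ : Set (Feature K N) → Prop) : Rule Pred 𝒞 :=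
  ⟨.atVar 0 x, .dnf p (featureFormula p aux) Φ ::
    (List.range N).map fun d => .or (.isBefore p d) (.isEarly p d)⟩

/-- The translation of an LDSR program. -/
def translation (kind : Pred → PredKind) (p : Pred) (aux : Pred → Pred)
    (P : Set (LDSR.Rule Pred Sym 𝒞)) (K : Set (Atom Pred 𝒞)) [Finite K] (N : ℕ) :
    Set (Rule Pred 𝒞) :=
  {r | ∃ g ∈ LDSR.ground P, r = ruleOf p aux K N (headAtom aux g) (bodyFunction K N g)} ∪
    {r | ∃ a ∈ K, kind a.pred = PredKind.intensional ∧ r = copyRule aux a}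

/-- The rule system of the translation. -/
def translationSystem (kind : Pred → PredKind) (aux : Pred → Pred)
    (P : Set (LDSR.Rule Pred Sym 𝒞)) (K : Set (Atom Pred 𝒞)) (B : Set (Atom Pred 𝒞)) {n : ℕ}
    (t : Fin (n + 1)) :
    RuleSystem (Atom Pred 𝒞) ({g : LDSR.GroundRule Pred 𝒞 // g ∈ LDSR.ground P} × Fin (n + 1) ⊕
      {a : Atom Pred 𝒞 // a ∈ K ∧ kind a.pred = PredKind.intensional}) n where
  head := Sum.elim (fun x => (x.2, headAtom aux x.1.1)) (fun a => (t, a.1))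
  body := Sum.elim (fun x S => x.1.1.BodyHolds (history aux B x.2 S))
    (fun a S => a.1.rename aux ∈ S t)

/-- There may be infinitely many pairs of a rule and a substitution, but a translated rule depends
only on a head from a finite set and a Boolean function of finitely many features. -/
theorem finite_translation [Finite K] (hK : LDSR.IsSupport P K N) :
    (translation kind p aux P K N).Finite := by
  refine Set.Finite.union ?_ ((hK.finite.image (copyRule aux)).subset ?_)
  · refine (Set.Finite.image2 (ruleOf p aux K N) (hK.finite.union
      (hK.finite.image (Atom.rename aux))) (Set.toFinite Set.univ)).subset ?_
    rintro _ ⟨g, hg, rfl⟩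
    refine Set.mem_image2_of_mem ?_ (Set.mem_univ _)
    unfold headAtom
    split_ifs
    · exact Or.inr ⟨_, head_mem hK hg, rfl⟩
    · exact Or.inl (head_mem hK hg)
  · rintro _ ⟨a, ha, -, rfl⟩
    exact ⟨a, ha, rfl⟩

theorem bodyHolds_ruleOf [Finite K] (hK : LDSR.IsSupport P K N) (haux : IsAux kind P aux)
    (hB : IsBackground kind B) {g : LDSR.GroundRule Pred 𝒞} (hg : g ∈ LDSR.ground P)
    {x : Atom Pred 𝒞} {σ : ℕ → 𝒞} {τ : ℕ → Fin (n + 1)} :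
    GroundRule.BodyHolds S B t ⟨ruleOf p aux K N x (bodyFunction K N g), σ, τ⟩ ↔
      (∀ d < N, (τ (d + 1) : ℕ) + (d + 1) = τ 0 ∨ (τ 0 : ℕ) ≤ d) ∧
        g.BodyHolds (history aux B (τ 0) S) := by
  simp only [GroundRule.BodyHolds, ruleOf, List.forall_mem_cons, List.forall_mem_map,
    List.mem_range, entails_dnf, Entails, entails_isBefore, entails_isEarly]
  rw [and_comm]
  refine and_congr_right fun hτ => ?_
  rw [entails_featureFormula haux hB hτ, bodyFunction_features hK hg.1]

/-- Heads are intensional, so none is satisfied by the background data alone; truth of a head is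
therefore membership in the stream, as rule systems require. -/
theorem translation_closed_iff [Finite K] (h𝒞 : 𝒞.Nonempty) (hK : LDSR.IsSupport P K N)
    (haux : IsAux kind P aux) (hhead : ∀ r ∈ P, kind r.head.pred = PredKind.intensional)
    (hB : IsBackground kind B) {Ω : FinStream (Atom Pred 𝒞) n} :
    (∀ g ∈ reduct (translation kind p aux P K N) S B t,
        g.BodyHolds Ω B t → g.HeadHolds Ω B t) ↔
      ∀ i, (translationSystem kind aux P K B t).body i S →
        (translationSystem kind aux P K B t).body i Ω →
        (translationSystem kind aux P K B t).HeadIn Ω i := by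
  constructor
  · rintro h (⟨⟨g, hg⟩, U⟩ | ⟨a, ha, hk⟩) hS hΩ
    -- Truncated subtraction gives the correct distance when it exists; when it does not, the early
    -- alternative holds.
    · let τ : ℕ → Fin (n + 1) := fun d => ⟨U - d, by omega⟩
      have hτ : ∀ d < N, (τ (d + 1) : ℕ) + (d + 1) = τ 0 ∨ (τ 0 : ℕ) ≤ d := by
        intro d _
        simp only [τ]
        omega
      have := h ⟨ruleOf p aux K N (headAtom aux g) (bodyFunction K N g), g.σ, τ⟩
        ⟨Or.inl ⟨g, hg, rfl⟩, (bodyHolds_ruleOf hK haux hB hg).2 ⟨hτ, hS⟩⟩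
        ((bodyHolds_ruleOf hK haux hB hg).2 ⟨hτ, hΩ⟩)
      exact (entails_atVar.1 this).resolve_right
        (notMem_background hB (kind_headAtom haux hhead hg))
    · have c : ℕ → 𝒞 := fun _ => ⟨_, h𝒞.choose_spec⟩
      have := h ⟨copyRule aux a, c, fun _ => t⟩
        ⟨Or.inr ⟨a, ha, hk, rfl⟩, (bodyHolds_copyRule hB haux).2 hS⟩
        ((bodyHolds_copyRule hB haux).2 hΩ)
      simp only [GroundRule.HeadHolds, copyRule, Entails, Atom.subst_lift, Set.mem_univ,
        true_and] at this
      exact this.resolve_right (notMem_background hB hk)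
  · rintro h ⟨r, σ, τ⟩ ⟨⟨g, hg, rfl⟩ | ⟨a, ha, hk, rfl⟩, hS⟩ hΩ
    · exact entails_atVar.2 (Or.inl (h (Sum.inl (⟨g, hg⟩, τ 0))
        ((bodyHolds_ruleOf hK haux hB hg).1 hS).2 ((bodyHolds_ruleOf hK haux hB hg).1 hΩ).2))
    · have := h (Sum.inr ⟨a, ha, hk⟩) ((bodyHolds_copyRule hB haux).1 hS)
        ((bodyHolds_copyRule hB haux).1 hΩ)
      simp only [GroundRule.HeadHolds, copyRule, Entails, Atom.subst_lift, Set.mem_univ, true_and]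
      exact Or.inl this

end Translation

end LARS

/-! ### Determinism and correctness of the translation. -/

namespace LARS

variable {Pred Sym : Type*} {𝒞 : Finset (Value Sym)}

/-- An atom and its renaming are interchangeable in bodies at their own time point, so they must
share a level. -/
theorem exists_isLevel_aux {kind : Pred → PredKind} {P : Set (LDSR.Rule Pred Sym 𝒞)}
    {aux : Pred → Pred} (haux : IsAux kind P aux) {lam : Pred → ℕ} (hlam : LDSR.IsLevel P lam) :
    ∃ lam', LDSR.IsLevel P lam' ∧ ∀ p ∈ LDSR.progPreds P, lam' (aux p) = lam' p := by
  classical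
  let lam' : Pred → ℕ := fun q => if q ∈ LDSR.progPreds P then lam q else
    if h : ∃ p ∈ LDSR.progPreds P, aux p = q then lam h.choose else 0
  have h₁ : ∀ p ∈ LDSR.progPreds P, lam' p = lam p := fun p hp => if_pos hp
  refine ⟨lam', fun r hr l hl => ?_, fun p hp => ?_⟩
  · rw [h₁ r.head.pred ⟨r, hr, Or.inl rfl⟩]
    refine ⟨fun p hp => ?_, fun p hp => ?_⟩
    · rw [h₁ p ⟨r, hr, Or.inr ⟨l, hl, Or.inl hp⟩⟩]
      exact (hlam r hr l hl).1 p hp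
    · rw [h₁ p ⟨r, hr, Or.inr ⟨l, hl, Or.inr hp⟩⟩]
      exact (hlam r hr l hl).2 p hp
  · have h : ∃ p' ∈ LDSR.progPreds P, aux p' = aux p := ⟨p, hp, rfl⟩
    rw [h₁ p hp]
    simp only [lam', if_neg (haux.notMem p), dif_pos h]
    rw [haux.injOn h.choose_spec.1 hp h.choose_spec.2]

theorem exists_isAux {kind : Pred → PredKind}
    (hfresh : {p | kind p = PredKind.intensional}.Infinite) {P : Set (LDSR.Rule Pred Sym 𝒞)}
    (hP : P.Finite) : ∃ aux, IsAux kind P aux := by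
  classical
  have hfin := LDSR.finite_progPreds hP
  have hinf := hfresh.sdiff hfin
  obtain ⟨T, hT, hcard⟩ := hinf.exists_subset_card_eq (hfin.toFinset.card)
  obtain ⟨q, hq⟩ := hinf.nonempty
  let e := Finset.equivOfCardEq hcard.symm
  -- Outside `P` injectivity is not needed, so one fresh name `q` serves all remaining predicates.
  refine ⟨fun p => if h : p ∈ hfin.toFinset then e ⟨p, h⟩ else q, ?_, ?_, ?_⟩
  · intro p hp p' hp' h
    have hp := hfin.mem_toFinset.2 hp
    have hp' := hfin.mem_toFinset.2 hp'
    simp only [dif_pos hp, dif_pos hp'] at h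
    simpa using e.injective (Subtype.ext h)
  · intro p
    split_ifs
    · exact (hT (e _).2).1
    · exact hq.1
  · intro p
    split_ifs
    · exact (hT (e _).2).2
    · exact hq.2

variable {kind : Pred → PredKind} {p : Pred} {aux : Pred → Pred}
  {P : Set (LDSR.Rule Pred Sym 𝒞)} {K : Set (Atom Pred 𝒞)} {N : ℕ} {B : Set (Atom Pred 𝒞)} {n : ℕ}
  {t : Fin (n + 1)} {I A : FinStream (Atom Pred 𝒞) n}

/-- The atoms of the answer stream of the translation, with the background data, that count in the
evaluation of `P`. -/
def visible (F : Set Pred) (B : Set (Atom Pred 𝒞)) (A : FinStream (Atom Pred 𝒞) n) :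
    FinStream (Atom Pred 𝒞) n :=
  fun i => {a | (a ∈ A i ∨ a ∈ B) ∧ a.pred ∈ F}

/-- The minimal model of `P` at the time point `U` that is encoded by the answer stream of the
translation. -/
def stepModel (aux : Pred → Pred) (P : Set (LDSR.Rule Pred Sym 𝒞)) (F : Set Pred)
    (B : Set (Atom Pred 𝒞)) (U : Fin (n + 1)) (A : FinStream (Atom Pred 𝒞) n) :
    FinStream (Atom Pred 𝒞) U :=
  fun j => {a | a ∈ visible F B A (Fin.castLE U.isLt j) ∨
    (j : ℕ) = U ∧ a.pred ∈ LDSR.progPreds P ∧ a.rename aux ∈ A U}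

/-- The input of `P` at the time point `U`. -/
def stepBase (F : Set Pred) (B : Set (Atom Pred 𝒞)) (I : FinStream (Atom Pred 𝒞) n)
    (U : Fin (n + 1)) (A : FinStream (Atom Pred 𝒞) n) : FinStream (Atom Pred 𝒞) U :=
  Function.update ((visible F B A).restrict U (Nat.le_of_lt_succ U.isLt)) (Fin.last U) (I U)

theorem stepBase_last {F : Set Pred} {U : Fin (n + 1)} :
    stepBase F B I U A (Fin.last U) = I U := by
  simp [stepBase]

theorem stepBase_of_lt {F : Set Pred} {U : Fin (n + 1)} {j : Fin (U + 1)} (hj : (j : ℕ) < U) :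
    stepBase F B I U A j = visible F B A (Fin.castLE U.isLt j) := by
  rw [stepBase, Function.update_of_ne (Fin.lt_last_iff_ne_last.1 hj)]
  rfl

theorem progPreds_subset : LDSR.progPreds P ⊆ tuplePreds P I B := fun _ h => Or.inl h

theorem pred_mem_of_mem_input {U : Fin (n + 1)} {a : Atom Pred 𝒞} (h : a ∈ I U) :
    a.pred ∈ tuplePreds P I B := Or.inr (Or.inl ⟨U, a, h, rfl⟩)

theorem pred_mem_of_mem_background {a : Atom Pred 𝒞} (h : a ∈ B) :
    a.pred ∈ tuplePreds P I B := Or.inr (Or.inr ⟨a, h, rfl⟩)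

theorem mem_progPreds (hI : IsInput kind I) (hB : IsBackground kind B) {q : Pred}
    (hq : q ∈ tuplePreds P I B) (hk : kind q = PredKind.intensional) : q ∈ LDSR.progPreds P := by
  rcases hq with h | ⟨i, a, ha, rfl⟩ | ⟨a, ha, rfl⟩
  · exact h
  · cases hk.symm.trans (hI i a ha)
  · cases hk.symm.trans (hB a ha)

/-- Input and background predicates are extensional, so intensional names new to `P` avoid them for
every choice of data. -/
theorem aux_notMem (haux : IsAux kind P aux) (hI : IsInput kind I) (hB : IsBackground kind B)
    (q : Pred) : aux q ∉ tuplePreds P I B := fun h =>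
  haux.notMem q (mem_progPreds hI hB h (haux.kind_eq q))

theorem stepBase_le_stepModel (h : I ≤ A) {U : Fin (n + 1)} :
    stepBase (tuplePreds P I B) B I U A ≤ stepModel aux P (tuplePreds P I B) B U A := by
  intro j a ha
  rcases (Fin.le_last j).lt_or_eq with hj | rfl
  · rw [stepBase_of_lt hj] at ha
    exact Or.inl ha
  · rw [stepBase_last] at ha
    exact Or.inl ⟨Or.inl (h U ha), pred_mem_of_mem_input ha⟩

theorem headAtom_mem_stepModel (hK : LDSR.IsSupport P K N) {U : Fin (n + 1)}
    {g : LDSR.GroundRule Pred 𝒞} (hg : g ∈ LDSR.ground P) (h : headAtom aux g ∈ A U) :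
    g.head ∈ stepModel aux P (tuplePreds P I B) B U A (Fin.last U) := by
  have hp := hK.pred_mem _ (head_mem hK hg)
  unfold headAtom at h
  split_ifs at h
  · exact Or.inr ⟨rfl, hp, h⟩
  · exact Or.inl ⟨Or.inl h, progPreds_subset hp⟩

variable [LinearOrder Sym]

/-- A body at `U` reads only time points up to `U`. A copy rule stays within one level, which is
allowed because it is monotone. -/
theorem translationSystem_isStratified (hK : LDSR.IsSupport P K N) {lam : Pred → ℕ}
    (hlam : LDSR.IsLevel P lam) (h : ∀ p ∈ LDSR.progPreds P, lam (aux p) = lam p) :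
    (translationSystem kind aux P K B t).IsStratified fun k a => toLex (k, lam a.pred) := by
  have mono : ∀ (U : Fin (n + 1)) (l : ℕ) (R : ℕ → ℕ → Prop) (S S' : FinStream (Atom Pred 𝒞) n),
      (∀ k, ∀ x ∈ S k, k < U ∨ k = U ∧ R (lam x.pred) l → x ∈ S' k) → ∀ d, ∀ a ∈ K,
      R (lam a.pred) l → LDSR.HoldsBefore (history aux B U S) d a →
      LDSR.HoldsBefore (history aux B U S') d a := by
    rintro U l R S S' hS d a ha hl ⟨i, hi, h₁ | h₁ | ⟨h₁, h₂⟩⟩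
    · refine ⟨i, hi, Or.inl (hS _ _ h₁ ?_)⟩
      rcases (Fin.le_last i).lt_or_eq with h | rfl
      · exact Or.inl h
      · exact Or.inr ⟨rfl, hl⟩
    · exact ⟨i, hi, Or.inr (Or.inl h₁)⟩
    · refine ⟨i, hi, Or.inr (Or.inr ⟨h₁, hS _ _ h₂ (Or.inr ⟨rfl, ?_⟩)⟩)⟩
      rwa [← h _ (hK.pred_mem a ha)] at hl
  rintro (⟨⟨g, hg⟩, U⟩ | ⟨a, ha, _⟩) S S' hS h₁ h₂
  · have e : lam (headAtom aux g).pred = lam g.head.pred := by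
      unfold headAtom
      split_ifs
      · exact h _ (hK.pred_mem _ (head_mem hK hg))
      · rfl
    simp only [translationSystem, Sum.elim_inl, Prod.Lex.toLex_le_toLex,
      Prod.Lex.toLex_lt_toLex, e] at h₁ h₂
    exact LDSR.GroundRule.BodyHolds.mono hK hlam hg.1 hS (fun _ _ => Iff.rfl)
      (fun d _ => mono U _ (· ≤ ·) S S' h₁ d) (fun d _ => mono U _ (· < ·) S' S h₂ d)
  · refine h₁ t _ hS ?_
    simp [translationSystem, Atom.rename, h _ (hK.pred_mem a ha)]

theorem kind_head (haux : IsAux kind P aux)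
    (hhead : ∀ r ∈ P, kind r.head.pred = PredKind.intensional) (i) :
    kind ((translationSystem kind aux P K B t).head i).2.pred = PredKind.intensional := by
  rcases i with ⟨⟨g, hg⟩, U⟩ | ⟨a, -, ha⟩
  · exact kind_headAtom haux hhead hg
  · exact ha

theorem isAnswerStream_translation_iff [Finite K] (h𝒞 : 𝒞.Nonempty) (hK : LDSR.IsSupport P K N)
    (haux : IsAux kind P aux) (hhead : ∀ r ∈ P, kind r.head.pred = PredKind.intensional)
    (hB : IsBackground kind B) :
    IsAnswerStream kind (translation kind p aux P K N) I B t A ↔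
      (translationSystem kind aux P K B t).IsAnswer I A := by
  constructor
  · rintro ⟨⟨hint, hmod⟩, hmin⟩
    refine ⟨hint.1, fun i hi => (translation_closed_iff h𝒞 hK haux hhead hB).1 hmod i hi hi, ?_⟩
    intro Ω hE hΩ hlt
    exact hmin Ω ⟨⟨hE, fun i a ha => hint.2 i a (hlt.le i ha)⟩,
      (translation_closed_iff h𝒞 hK haux hhead hB).2 hΩ⟩ hlt
  · intro h
    refine ⟨⟨⟨h.1, fun i a ha hI => ?_⟩,
      (translation_closed_iff h𝒞 hK haux hhead hB).2 fun i hi _ => h.2.1 i hi⟩, fun Ω hΩ => ?_⟩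
    · obtain ha | ⟨j, hj, -⟩ := h.supported ha
      · exact absurd ha hI
      · have := kind_head (K := K) (B := B) (t := t) haux hhead j
        rwa [hj] at this
    · exact h.2.2 Ω hΩ.1.1 ((translation_closed_iff h𝒞 hK haux hhead hB).1 hΩ.2)

theorem isDeterministic_translation [Finite K] (h𝒞 : 𝒞.Nonempty) (hK : LDSR.IsSupport P K N)
    (haux : IsAux kind P aux) (hhead : ∀ r ∈ P, kind r.head.pred = PredKind.intensional)
    {lam : Pred → ℕ} (hlam : LDSR.IsLevel P lam) :
    IsDeterministic kind (translation kind p aux P K N) := by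
  obtain ⟨lam', hlam', h⟩ := exists_isLevel_aux haux hlam
  refine ⟨finite_translation hK, fun n I B t hI hB => ?_⟩
  have hs := translationSystem_isStratified (kind := kind) (B := B) (t := t) hK hlam' h
  simp only [isAnswerStream_translation_iff h𝒞 hK haux hhead hB]
  obtain ⟨S, hS⟩ := RuleSystem.exists_isAnswer hs I
  exact ⟨S, hS, fun S' hS' => RuleSystem.IsAnswer.unique hs hS' hS⟩

theorem bodyHolds_stepModel_iff (hK : LDSR.IsSupport P K N) {U : Fin (n + 1)}
    {g : LDSR.GroundRule Pred 𝒞} (hg : g.rule ∈ P) :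
    g.BodyHolds (stepModel aux P (tuplePreds P I B) B U A) ↔ g.BodyHolds (history aux B U A) := by
  have : ∀ d ≤ N, ∀ a ∈ K,
      LDSR.HoldsBefore (stepModel aux P (tuplePreds P I B) B U A) d a ↔
        LDSR.HoldsBefore (history aux B U A) d a := by
    intro d _ a ha
    have h₁ := hK.pred_mem a ha
    have h₂ : a.pred ∈ tuplePreds P I B := progPreds_subset h₁
    refine exists_congr fun i => and_congr_right fun _ => ?_
    simp only [stepModel, visible, history, Set.mem_ofPred_eq]
    tauto
  exact ⟨fun h => h.congr hK hg (fun _ _ => Iff.rfl) this,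
    fun h => h.congr hK hg (fun _ _ => Iff.rfl) fun d hd a ha => (this d hd a ha).symm⟩

theorem mem_input_of_notMem_progPreds (haux : IsAux kind P aux)
    (hhead : ∀ r ∈ P, kind r.head.pred = PredKind.intensional) (hI : IsInput kind I)
    (hB : IsBackground kind B) (hA : (translationSystem kind aux P K B t).IsAnswer I A)
    {U : Fin (n + 1)} {a : Atom Pred 𝒞} (ha : a ∈ A U) (hF : a.pred ∈ tuplePreds P I B)
    (hp : a.pred ∉ LDSR.progPreds P) : a ∈ I U := by
  obtain ha | ⟨j, hj, -⟩ := hA.supported ha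
  · exact ha
  · have := kind_head (K := K) (B := B) (t := t) haux hhead j
    rw [hj] at this
    exact absurd (mem_progPreds hI hB hF this) hp

/-- Minimality at a single time point is inherited from minimality of the whole stream: a smaller
model of the step would allow `A` to be thinned at `U` alone while remaining a model of the reduct.
-/
theorem isAnswer_stepModel (h𝒞 : 𝒞.Nonempty) (hK : LDSR.IsSupport P K N)
    (haux : IsAux kind P aux) (hhead : ∀ r ∈ P, kind r.head.pred = PredKind.intensional)
    (hI : IsInput kind I) (hB : IsBackground kind B)
    (hA : (translationSystem kind aux P K B t).IsAnswer I A) (U : Fin (n + 1)) :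
    (LDSR.stepSystem (P ∪ LDSR.facts B) U).IsAnswer (stepBase (tuplePreds P I B) B I U A)
      (stepModel aux P (tuplePreds P I B) B U A) := by
  set F := tuplePreds P I B
  refine ⟨stepBase_le_stepModel hA.1, ?_, ?_⟩
  · rintro ⟨g, hg⟩ h
    rcases LDSR.mem_ground_union_facts hg with hg' | hg'
    · exact headAtom_mem_stepModel hK hg'
        (hA.2.1 (Sum.inl (⟨g, hg'⟩, U)) ((bodyHolds_stepModel_iff hK hg'.1).1 h))
    · exact Or.inl ⟨Or.inr hg'.1, pred_mem_of_mem_background hg'.1⟩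
  · intro Ω hE hΩ hlt
    have hfacts : ∀ b ∈ B, b ∈ Ω (Fin.last U) := by
      intro b hb
      obtain ⟨g, hg, rfl, -, hbody⟩ := LDSR.exists_fact h𝒞 P hb
      have : ∀ S : FinStream (Atom Pred 𝒞) U, g.BodyHolds S := fun S l hl => by
        simp [hbody] at hl
      exact hΩ ⟨g, hg⟩ (this _) (this _)
    -- At `U` an atom of `P` and its renaming are both deleted when the atom is missing from `Ω`.
    -- Other time points and unrelated predicates stay as in `A`.
    let Ω' : FinStream (Atom Pred 𝒞) n := fun k => {x | x ∈ A k ∧ (k = U →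
      ∀ a : Atom Pred 𝒞, a.pred ∈ LDSR.progPreds P → x = a ∨ x = a.rename aux →
        a ∈ Ω (Fin.last U))}
    have hΩ'le : Ω' ≤ A := fun k x hx => hx.1
    have mem₁ : ∀ a : Atom Pred 𝒞, a.pred ∈ LDSR.progPreds P →
        (a ∈ Ω' U ↔ a ∈ A U ∧ a ∈ Ω (Fin.last U)) := by
      refine fun a ha => ⟨fun h => ⟨h.1, h.2 rfl a ha (Or.inl rfl)⟩, fun h => ⟨h.1, ?_⟩⟩
      rintro - a' ha' (rfl | rfl)
      · exact h.2
      · exact absurd ha (haux.notMem _)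
    have mem₂ : ∀ a : Atom Pred 𝒞, a.pred ∈ LDSR.progPreds P →
        (a.rename aux ∈ Ω' U ↔ a.rename aux ∈ A U ∧ a ∈ Ω (Fin.last U)) := by
      refine fun a ha => ⟨fun h => ⟨h.1, h.2 rfl a ha (Or.inr rfl)⟩, fun h => ⟨h.1, ?_⟩⟩
      rintro - a' ha' (rfl | e)
      · exact absurd ha' (haux.notMem _)
      · rw [← Atom.rename_injOn haux.injOn ha ha' e]
        exact h.2
    have hbody : ∀ g ∈ LDSR.ground P, g.BodyHolds (history aux B U Ω') → g.BodyHolds Ω := by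
      refine fun g hg h => h.congr hK hg.1 (fun _ _ => Iff.rfl) fun d _ a ha => ?_
      have hap := hK.pred_mem a ha
      have haF : a.pred ∈ F := progPreds_subset hap
      refine exists_congr fun j => and_congr_right fun _ => ?_
      rcases (Fin.le_last j).lt_or_eq with hj | rfl
      -- Before `U` the base and the step model coincide, so `Ω` is squeezed between them.
      · have h₁ : a ∈ Ω j ↔ a ∈ visible F B A (Fin.castLE U.isLt j) := by
          refine ⟨fun h => (hlt.le j h).resolve_right fun h => hj.ne (Fin.ext h.1), fun h => ?_⟩
          exact hE j (by rwa [stepBase_of_lt hj])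
        have h₂ : Fin.castLE U.isLt j ≠ U := fun e =>
          hj.ne (Fin.ext (congrArg (fun k : Fin (n + 1) => (k : ℕ)) e))
        have h₃ : (j : ℕ) ≠ U := fun e => hj.ne (Fin.ext e)
        rw [h₁]
        simp only [history, visible, Ω', Set.mem_ofPred_eq, h₂, h₃, false_imp_iff, false_and,
          and_true, or_false, haF]
      · have h₁ : Fin.castLE U.isLt (Fin.last U) = U := rfl
        have h₂ : a ∈ Ω (Fin.last U) → _ := fun h => hlt.le (Fin.last U) h
        have h₃ := hfacts a
        simp only [stepModel, visible, Set.mem_ofPred_eq, h₁, Fin.val_last, true_and] at h₂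
        simp only [history, Set.mem_ofPred_eq, h₁, Fin.val_last, true_and, mem₁ a hap, mem₂ a hap]
        tauto
    have hEq : Ω' = A := by
      refine hA.eq_of_le hΩ'le (fun k a ha => ⟨hA.1 k ha, ?_⟩) ?_
      · rintro rfl a' ha' (rfl | rfl)
        · exact hE _ (by rwa [stepBase_last])
        · cases (haux.kind_eq a'.pred).symm.trans (hI _ _ ha)
      · rintro (⟨⟨g, hg⟩, V⟩ | ⟨a, ha, hk⟩) h h'
        · have hmem : headAtom aux g ∈ A V := hA.2.1 (Sum.inl (⟨g, hg⟩, V)) h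
          by_cases hV : V = U
          · subst hV
            have hgΩ : g.head ∈ Ω (Fin.last V) := hΩ ⟨g, Or.inl hg.1, hg.2⟩
              ((bodyHolds_stepModel_iff hK hg.1).2 h) (hbody g hg h')
            have hp := hK.pred_mem _ (head_mem hK hg)
            show headAtom aux g ∈ Ω' V
            unfold headAtom at hmem ⊢
            split_ifs at hmem ⊢
            · exact (mem₂ _ hp).2 ⟨hmem, hgΩ⟩
            · exact (mem₁ _ hp).2 ⟨hmem, hgΩ⟩
          · exact ⟨hmem, fun e => absurd e hV⟩
        · have hmem : a ∈ A t := hA.2.1 (Sum.inr ⟨a, ha, hk⟩) h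
          by_cases hV : t = U
          · subst hV
            have hp := hK.pred_mem _ ha
            exact (mem₁ _ hp).2 ⟨hmem, ((mem₂ _ hp).1 h').2⟩
          · exact ⟨hmem, fun e => absurd e hV⟩
    -- Since nothing was deleted from `A`, the stream `Ω` already contains the whole step model.
    refine hlt.not_ge fun j a ha => ?_
    rcases (Fin.le_last j).lt_or_eq with hj | rfl
    · refine hE j ?_
      rw [stepBase_of_lt hj]
      exact ha.resolve_right fun h => hj.ne (Fin.ext h.1)
    · obtain ⟨ha | ha, haF⟩ | ⟨-, hp, ha⟩ := ha
      · by_cases hp : a.pred ∈ LDSR.progPreds P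
        · rw [← hEq] at ha
          exact ((mem₁ a hp).1 ha).2
        · refine hE _ ?_
          rw [stepBase_last]
          exact mem_input_of_notMem_progPreds haux hhead hI hB hA ha haF hp
      · exact hfacts a ha
      · rw [← hEq] at ha
        exact ((mem₂ a hp).1 ha).2

/-- Away from `t` there is no copy rule, so an unrenamed atom outside the input and the background
is supported by a rule of form (1). Temporary atoms without other support occur only renamed and are
therefore invisible. -/
theorem permanentPart_stepModel (h𝒞 : 𝒞.Nonempty) (hK : LDSR.IsSupport P K N)
    (haux : IsAux kind P aux) (hI : IsInput kind I) (hB : IsBackground kind B)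
    (hA : (translationSystem kind aux P K B t).IsAnswer I A) {U : Fin (n + 1)} (hU : U ≠ t) :
    LDSR.permanentPart (P ∪ LDSR.facts B) (stepBase (tuplePreds P I B) B I U A)
      (stepModel aux P (tuplePreds P I B) B U A) =
      (visible (tuplePreds P I B) B A).restrict U (Nat.le_of_lt_succ U.isLt) := by
  funext j
  rcases (Fin.le_last j).lt_or_eq with hj | rfl
  · rw [LDSR.permanentPart, Function.update_of_ne (Fin.lt_last_iff_ne_last.1 hj)]
    ext a
    refine ⟨fun h => h.resolve_right fun h => hj.ne (Fin.ext h.1), Or.inl⟩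
  · rw [LDSR.permanentPart, Function.update_self]
    ext a
    simp only [LDSR.temporary, stepBase_last, Set.mem_sdiff, Set.mem_ofPred_eq, not_and, not_not]
    constructor
    · rintro ⟨h, ha⟩
      by_cases haI : a ∈ I U
      · exact ⟨Or.inl (hA.1 U haI), pred_mem_of_mem_input haI⟩
      · obtain ⟨g, hg, htemp, hb, rfl⟩ := ha h haI
        rcases LDSR.mem_ground_union_facts hg with hg' | hg'
        · have := hA.2.1 (Sum.inl (⟨g, hg'⟩, U)) ((bodyHolds_stepModel_iff hK hg'.1).1 hb)
          change headAtom aux g ∈ A U at this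
          rw [headAtom, htemp] at this
          exact ⟨Or.inl this, progPreds_subset (hK.pred_mem _ (head_mem hK hg'))⟩
        · exact ⟨Or.inr hg'.1, pred_mem_of_mem_background hg'.1⟩
    · intro h
      refine ⟨Or.inl h, fun _ haI => ?_⟩
      obtain ⟨ha | ha, hF⟩ := h
      · obtain ha | ⟨⟨⟨g, hg⟩, V⟩ | ⟨a', _, _⟩, hj, hb⟩ := hA.supported ha
        · exact absurd ha haI
        · simp only [translationSystem, Sum.elim_inl, Prod.mk.injEq] at hj hb
          obtain ⟨rfl, rfl⟩ := hj
          have htemp : g.rule.temp = false := by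
            by_contra hne
            rw [Bool.not_eq_false] at hne
            rw [headAtom, hne] at hF
            exact aux_notMem haux hI hB _ hF
          refine ⟨g, ⟨Or.inl hg.1, hg.2⟩, htemp, (bodyHolds_stepModel_iff hK hg.1).2 hb, ?_⟩
          simp [headAtom, htemp]
        · simp only [translationSystem, Sum.elim_inr, Prod.mk.injEq] at hj
          exact absurd hj.1.symm hU
      · obtain ⟨g, hg, rfl, htemp, hbody⟩ := LDSR.exists_fact h𝒞 P ha
        exact ⟨g, hg, htemp, fun l hl => by simp [hbody] at hl, rfl⟩

/-- A renamed atom at `t` can be supported only by a temporary rule. By injectivity of the renaming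
its original is that rule's head, hence intensional and in `K`, so a copy rule exists and makes it
visible. -/
theorem stepModel_self (hK : LDSR.IsSupport P K N) (haux : IsAux kind P aux)
    (hhead : ∀ r ∈ P, kind r.head.pred = PredKind.intensional) (hI : IsInput kind I)
    (hA : (translationSystem kind aux P K B t).IsAnswer I A) :
    stepModel aux P (tuplePreds P I B) B t A =
      (visible (tuplePreds P I B) B A).restrict t (Nat.le_of_lt_succ t.isLt) := by
  funext j
  ext a
  refine ⟨?_, Or.inl⟩
  rintro (h | ⟨hj, hp, ha⟩)
  · exact h
  obtain rfl : j = Fin.last t := Fin.ext hj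
  refine ⟨Or.inl ?_, progPreds_subset hp⟩
  obtain ha' | ⟨⟨⟨g, hg⟩, V⟩ | ⟨a', ha', _⟩, he, hb⟩ := hA.supported ha
  · cases (haux.kind_eq a.pred).symm.trans (hI _ _ ha')
  · simp only [translationSystem, Sum.elim_inl, Prod.mk.injEq] at he
    obtain ⟨rfl, he⟩ := he
    have hgp := hK.pred_mem _ (head_mem hK hg)
    unfold headAtom at he
    split_ifs at he
    · have e := Atom.rename_injOn haux.injOn hgp hp he
      subst e
      exact hA.2.1 (Sum.inr ⟨g.head, head_mem hK hg, hhead _ hg.1⟩) ha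
    · rw [he] at hgp
      exact absurd hgp (haux.notMem _)
  · simp only [translationSystem, Sum.elim_inr, Prod.mk.injEq] at he
    have := hK.pred_mem _ ha'
    rw [he.2] at this
    exact absurd this (haux.notMem _)

theorem isAnswerStream_visible (h𝒞 : 𝒞.Nonempty) (hK : LDSR.IsSupport P K N)
    (haux : IsAux kind P aux) (hhead : ∀ r ∈ P, kind r.head.pred = PredKind.intensional)
    (hI : IsInput kind I) (hB : IsBackground kind B)
    (hA : (translationSystem kind aux P K B t).IsAnswer I A) :
    LDSR.IsAnswerStream (P ∪ LDSR.facts B) (I.restrict t (Nat.le_of_lt_succ t.isLt))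
      ((visible (tuplePreds P I B) B A).restrict t (Nat.le_of_lt_succ t.isLt)) := by
  have key := fun U => LDSR.isMinimalModel_reduct_iff.2
    (isAnswer_stepModel h𝒞 hK haux hhead hI hB hA U)
  refine ⟨fun i a ha => ⟨Or.inl (hA.1 _ ha), pred_mem_of_mem_input ha⟩, fun i hi => ?_, ?_⟩
  · exact ⟨_, key ⟨i, by omega⟩, (permanentPart_stepModel h𝒞 hK haux hI hB hA
      (U := ⟨i, by omega⟩) fun e => hi.ne (congrArg Fin.val e)).symm⟩
  · have := key t
    rw [stepModel_self hK haux hhead hI hA] at this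
    exact this

end LARS

end StreamReasoning

/-! ### Bound-expressibility of the fragment. -/

theorem mainTheorem7 {Pred Sym : Type*} [LinearOrder Sym]
    (kind : Pred → StreamReasoning.PredKind)
    (hfresh : {p | kind p = StreamReasoning.PredKind.intensional}.Infinite)
    (𝒞 : Finset (StreamReasoning.Value Sym)) (h𝒞 : 𝒞.Nonempty) :
    StreamReasoning.BoundExpressible kind 𝒞 (StreamReasoning.F4 kind 𝒞) := by
  open StreamReasoning in
  obtain ⟨p, -⟩ := hfresh.nonempty
  have hρ : ∀ P : {P // P ∈ F4 kind 𝒞},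
      ∃ Q : {Q : Set (LARS.Rule Pred 𝒞) // LARS.IsDeterministic kind Q},
        ∀ (n : ℕ) (I : FinStream (Atom Pred 𝒞) n) (B : Set (Atom Pred 𝒞)) (t : Fin (n + 1)),
          IsInput kind I → IsBackground kind B → ∃ O O' : FinStream (Atom Pred 𝒞) n,
            (∀ X, LDSR.IsBoundOutput P.1 I B t X ↔ X = O) ∧
            (∀ X, LARS.IsBoundOutput kind Q.1 I B t X ↔ X = O') ∧
            O = O'.filterPred (tuplePreds P.1 I B) := by
    rintro ⟨P, ⟨hfin, -, hstrat⟩, hhead⟩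
    obtain ⟨K, N, hK⟩ := LDSR.exists_isSupport hfin
    obtain ⟨lam, hlam⟩ := LDSR.Stratified.exists_isLevel hfin hstrat
    obtain ⟨aux, haux⟩ := LARS.exists_isAux hfresh hfin
    have : Finite K := hK.finite
    have hdet := LARS.isDeterministic_translation (p := p) h𝒞 hK haux hhead hlam
    refine ⟨⟨_, hdet⟩, fun n I B t hI hB => ?_⟩
    obtain ⟨A, hA, huniq⟩ := hdet.2 n I B t hI hB
    have hL := LARS.isAnswerStream_visible h𝒞 hK haux hhead hI hB
      ((LARS.isAnswerStream_translation_iff h𝒞 hK haux hhead hB).1 hA)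
    refine ⟨_, _, fun X => ⟨?_, fun h => ⟨_, hL, h⟩⟩, fun X => ⟨?_, fun h => ⟨A, hA, h⟩⟩, ?_⟩
    · rintro ⟨A', hA', rfl⟩
      rw [LDSR.IsAnswerStream.unique hK hlam hA' hL]
    · rintro ⟨A', hA', rfl⟩
      rw [huniq A' hA']
    · funext i
      ext a
      by_cases hi : (i : ℕ) ≤ t
      · simp only [FinStream.filterPred, hi, if_true, dif_pos]
        rfl
      · simp [FinStream.filterPred, hi]
  choose ρ h using hρ
  exact ⟨ρ, h⟩
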